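/- **Setting.** Let $\Lambda f(s)=f(s+1)$, $\Delta=\Lambda-1$, $\Delta^*=\Lambda^{-1}-1$. All coefficients are complex functions of $s\in\mathbb R$ and of the times $\boldsymbol x=(\boldsymbol x^{(1)},\boldsymbol x^{(2)})$, $\boldsymbol x^{(a)}=(x^{(a)}_1,x^{(a)}_2,\dots)$, the dependence on $\boldsymbol x$ being by formal power series at a point $\boldsymbol x^\circ$ with finitely many nonzero coordinates. For an operator $A=\sum_j a_j\Lambda^j$ put $$A_{\Delta,\ge1}=\sum_{j\ge1}a_j(\Lambda^j-1),\quad A_{\Delta,\le0}=A-A_{\Delta,\ge1},\quad A_{\Delta^*,\ge1}=\sum_{j\ge1}a_{-j}(\Lambda^{-j}-1),\quad A_{\Delta^*,\le0}=A-A_{\Delta^*,\ge1}$$ (the parts in positive and nonpositive powers of $\Delta$, resp. $\Delta^*$). Let $W_1=\sum_{i\ge0}w^{(1)}_i\Lambda^{-i}$ and $W_2=\sum_{i\ge0}w^{(2)}_i\Lambda^{i}$ with $w^{(1)}_0,w^{(2)}_0$ invertible, $L_1=W_1\Lambda W_1^{-1}$, $L_2=W_2\Lambda^{-1}W_2^{-1}$,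 $$M_1=W_1\Big(s\Lambda^{-1}+\sum_{k\ge1}kx^{(1)}_k\Lambda^{k-1}\Big)W_1^{-1},\qquad M_2=W_2\Big(-s\Lambda+\sum_{k\ge1}kx^{(2)}_k\Lambda^{1-k}\Big)W_2^{-1}.$$ For integers $N,M\ge1$, $(W_1,W_2)$ is a solution of the $(N,M)$-bigraded modified Toda hierarchy if for all $k\ge1$ $$\partial_{x^{(1)}_k}W_1=-(L_1^k)_{\Delta,\le0}W_1,\quad \partial_{x^{(1)}_k}W_2=(L_1^k)_{\Delta,\ge1}W_2,\quad \partial_{x^{(2)}_k}W_1=(L_2^k)_{\Delta^*,\ge1}W_1,\quad \partial_{x^{(2)}_k}W_2=-(L_2^k)_{\Delta^*,\le0}W_2,$$ and $L_1^N=L_2^M$, $(L_1^N+L_2^M)(1)=0$. Its tau functions $\tau_0,\tau_1$ are functions of $(s,\boldsymbol x)$, nonzero at $\boldsymbol x=\boldsymbol x^\circ$ for every $s$, with $$\sum_{i\ge0}w^{(1)}_i(s)z^{-i}=\frac{G_1(z)\tau_0(s)}{\tau_1(s)},\quad \sum_{i\ge0}w^{(2)}_i(s)z^{i}=\frac{G_2(z)\tau_0(s+1)}{\tau_1(s)},\qquad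 G_1(z)=e^{-\sum_{i\ge1}\frac{z^{-i}}{i}\partial_{x^{(1)}_i}},\quad G_2(z)=e^{-\sum_{i\ge1}\frac{z^{i}}{i}\partial_{x^{(2)}_i}} .$$ The Virasoro symmetries, for $l\ge-1$, are the vector fields $$\partial_{s_l}W_1=\Big(\tfrac1M(M_2L_2^{Ml+1})_{\Delta^*,\ge1}-\tfrac1N(M_1L_1^{Nl+1})_{\Delta,\le0}\Big)W_1,\qquad \partial_{s_l}W_2=\Big(\tfrac1N(M_1L_1^{Nl+1})_{\Delta,\ge1}-\tfrac1M(M_2L_2^{Ml+1})_{\Delta^*,\le0}\Big)W_2 .$$ Let $X_a(\lambda,\mu)=\exp\big(\sum_{k\ge1}x^{(a)}_k(\mu^k-\lambda^k)\big)\exp\big(\sum_{k\ge1}\tfrac1k(\lambda^{-k}-\mu^{-k})\partial_{x^{(a)}_k}\big)$, and define $W^{(a)}_{s,l,m}$ by the expansions $$\Big(\frac\mu\lambda\Big)^{s}X_1(\lambda,\mu)=\sum_{m\ge0}\frac{(\mu-\lambda)^m}{m!}\sum_{l\in\mathbb Z}\lambda^{-m-l}W^{(1)}_{s,l,m},\qquad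 \Big(\frac\lambda\mu\Big)^{s}X_2(\lambda,\mu)=\sum_{m\ge0}\frac{(\mu-\lambda)^m}{m!}\sum_{l\in\mathbb Z}\lambda^{-m-l}W^{(2)}_{s,l,m}.$$ **Statement.** For every $l\ge-1$ the symmetry $\partial_{s_l}$ is induced, through the above expressions of $W_1,W_2$ in terms of $\tau_0,\tau_1$, by $$\partial_{s_l}\tau_0(s)=\frac12\Big(\frac1NW^{(1)}_{s,Nl,2}+\frac1MW^{(2)}_{s-1,Ml,2}\Big)\tau_0(s),\qquad \partial_{s_l}\tau_1(s)=\frac12\Big(\frac1NW^{(1)}_{s+1,Nl,2}+\frac1MW^{(2)}_{s-1,Ml,2}\Big)\tau_1(s):$$ if $\tau_0,\tau_1$ change infinitesimally by the right-hand sides, then $W_1,W_2$ change by $\partial_{s_l}W_1,\partial_{s_l}W_2$. Moreover this action on the tau functions is unique up to their normalization: any infinitesimal change $(\delta\tau_0,\delta\tau_1)$ that induces $\partial_{s_l}$ on $(W_1,W_2)$ equals the right-hand sides plus $(c(s)\tau_0(s),c(s)\tau_1(s))$, where $c$ does not depend on $\boldsymbol x$ and $c(s+1)=c(s)$. -/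

import Mathlib

open Finset

noncomputable section

namespace BMTH

/-! ### Functions of the times -/

/-- Formal power series in `x - x₀`, where `x = (x^{(1)}, x^{(2)})` are the times.  The index
`(a, k)` stands for the time `x^{(a+1)}_k`, `k ≥ 1`. -/
abbrev TimeSeries : Type := MvPowerSeries (Fin 2 × ℕ+) ℂ

/-- The function `x^{(a+1)}_k`, expanded at the base point `x₀` (and `0` for `k = 0`). -/
def time (x₀ : Fin 2 × ℕ+ →₀ ℂ) (a : Fin 2) (k : ℕ) : TimeSeries :=
  if h : 0 < k then MvPowerSeries.C (x₀ (a, ⟨k, h⟩)) + MvPowerSeries.X (a, ⟨k, h⟩) else 0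

/-- The derivation `∂ / ∂x^{(a+1)}_k` (and `0` for `k = 0`). -/
def timeDeriv (a : Fin 2) (k : ℕ) : Module.End ℂ TimeSeries :=
  if h : 0 < k then (MvPowerSeries.pderiv ℂ (a, ⟨k, h⟩)).toLinearMap else 0

/-- The sum of a locally finite family of power series: every coefficient is the sum of the
finitely many nonzero contributions to it. -/
def lsum {ι : Type} (f : ι → TimeSeries) : TimeSeries :=
  fun γ => ∑ᶠ i, MvPowerSeries.coeff γ (f i)

/-! ### Difference operators -/

/-- The formal operator `∑ₙ aₙ(s) Λⁿ`, given by its coefficients; `Λ f(s) = f(s + 1)`. -/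
abbrev DiffOp : Type := ℤ → ℝ → TimeSeries

namespace DiffOp

/-- `(∑ aᵢ Λⁱ)(∑ bⱼ Λʲ) = ∑ₙ (∑ᵢ aᵢ(s) bₙ₋ᵢ(s + i)) Λⁿ`. -/
def mul (A B : DiffOp) : DiffOp :=
  fun n s => lsum fun i : ℤ => A i s * B (n - i) (s + i)

/-- The action `(∑ aᵢ Λⁱ)(f)(s) = ∑ᵢ aᵢ(s) f(s + i)`. -/
def apply (A : DiffOp) (f : ℝ → TimeSeries) : ℝ → TimeSeries :=
  fun s => lsum fun i : ℤ => A i s * f (s + i)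

/-- `Λᵖ`. -/
def shift (p : ℤ) : DiffOp := fun n _ => if n = p then 1 else 0

/-- The derivative of the coefficients with respect to the time `x^{(a+1)}_k`. -/
def deriv (a : Fin 2) (k : ℕ) (A : DiffOp) : DiffOp := fun n s => timeDeriv a k (A n s)

/-- `A_{Δ,≥1}` with `Δ = Λ - 1`, for `A` expanded in decreasing powers of `Δ`.  For `j ≥ 1` the
part of `Λʲ = (1 + Δ)ʲ` in positive powers of `Δ` is `Λʲ - 1`; for `j ≤ 0` the operator `Λʲ`
has no positive power of `Δ`.  Hence `A_{Δ,≥1} = ∑_{j ≥ 1} aⱼ (Λʲ - 1)`. -/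
def deltaPos (A : DiffOp) : DiffOp := fun n s =>
  if 1 ≤ n then A n s else if n = 0 then -lsum (fun j : ℕ => A (j + 1) s) else 0

/-- `A_{Δ,≤0}`, the complementary part in nonpositive powers of `Δ`. -/
def deltaNonpos (A : DiffOp) : DiffOp := A - deltaPos A

/-- `A_{Δ*,≥1}` with `Δ* = Λ⁻¹ - 1`, for `A` expanded in decreasing powers of `Δ*`:
`A_{Δ*,≥1} = ∑_{j ≥ 1} a₋ⱼ (Λ⁻ʲ - 1)`. -/
def deltaStarPos (A : DiffOp) : DiffOp := fun n s =>
  if n ≤ -1 then A n s else if n = 0 then -lsum (fun j : ℕ => A (-(j + 1)) s) else 0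

/-- `A_{Δ*,≤0}`, the complementary part in nonpositive powers of `Δ*`. -/
def deltaStarNonpos (A : DiffOp) : DiffOp := A - deltaStarPos A

end DiffOp

infixl:70 " ⋆ " => DiffOp.mul

open DiffOp

/-! ### Dressing operators -/

/-- `∑_{i ≥ 0} wᵢ Λ⁻ⁱ`. -/
def lowerOp (w : ℕ → ℝ → TimeSeries) : DiffOp :=
  fun n s => if n ≤ 0 then w (-n).toNat s else 0

/-- `∑_{i ≥ 0} wᵢ Λⁱ`. -/
def upperOp (w : ℕ → ℝ → TimeSeries) : DiffOp :=
  fun n s => if 0 ≤ n then w n.toNat s else 0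

/-- The coefficients `vⱼ` of the inverse `∑ⱼ vⱼ Λ^{σj}` of `∑ᵢ wᵢ Λ^{σi}`, `σ = ±1`, determined by
`∑_{i+j=n} wᵢ(s) vⱼ(s + σi) = δ_{n,0}`; it is used where the `w₀(s)` are invertible. -/
def invCoeff (σ : ℤ) (w : ℕ → ℝ → TimeSeries) : ℕ → ℝ → TimeSeries
  | 0, s => (w 0 s)⁻¹
  | n + 1, s => -(w 0 s)⁻¹ *
      ∑ i : Fin (n + 1), w (i + 1) s * invCoeff σ w (n - i) (s + (σ * (i + 1) : ℤ))
termination_by n _ => n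
decreasing_by omega

theorem sum_mul_invCoeff (σ : ℤ) (w : ℕ → ℝ → TimeSeries)
    (hw : ∀ s, MvPowerSeries.constantCoeff (w 0 s) ≠ 0) (n : ℕ) (s : ℝ) :
    ∑ i ∈ range (n + 1), w i s * invCoeff σ w (n - i) (s + (σ * i : ℤ)) =
      if n = 0 then 1 else 0 := by
  cases n with
  | zero => simp [invCoeff, MvPowerSeries.mul_inv_cancel _ (hw s)]
  | succ n =>
    rw [sum_range_succ', sum_range]
    have h := MvPowerSeries.mul_inv_cancel _ (hw s)
    have e : invCoeff σ w (n + 1 - 0) (s + ((σ * ((0 : ℕ) : ℤ) : ℤ) : ℝ)) =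
        -(w 0 s)⁻¹ * ∑ i : Fin (n + 1),
          w (i + 1) s * invCoeff σ w (n - i) (s + (σ * (i + 1) : ℤ)) := by
      simp [invCoeff]
    rw [e, ← mul_assoc, mul_neg, h]
    simp

/-- `L₁ᵖ = W₁ Λᵖ W₁⁻¹`, `p ∈ ℤ`, for `W₁ = ∑ wᵢ Λ⁻ⁱ`. -/
def L₁pow (w₁ : ℕ → ℝ → TimeSeries) (p : ℤ) : DiffOp :=
  lowerOp w₁ ⋆ shift p ⋆ lowerOp (invCoeff (-1) w₁)

/-- `L₂ᵖ = W₂ Λ⁻ᵖ W₂⁻¹`, `p ∈ ℤ`, for `W₂ = ∑ wᵢ Λⁱ`. -/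
def L₂pow (w₂ : ℕ → ℝ → TimeSeries) (p : ℤ) : DiffOp :=
  upperOp w₂ ⋆ shift (-p) ⋆ upperOp (invCoeff 1 w₂)

/-- `s Λ⁻¹ + ∑_{k ≥ 1} k x^{(1)}_k Λ^{k-1}`. -/
def bareM₁ (x₀ : Fin 2 × ℕ+ →₀ ℂ) : DiffOp := fun n s =>
  if n = -1 then MvPowerSeries.C (s : ℂ)
  else if 0 ≤ n then ((n : ℂ) + 1) • time x₀ 0 (n + 1).toNat else 0

/-- `-s Λ + ∑_{k ≥ 1} k x^{(2)}_k Λ^{1-k}`. -/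
def bareM₂ (x₀ : Fin 2 × ℕ+ →₀ ℂ) : DiffOp := fun n s =>
  if n = 1 then -MvPowerSeries.C (s : ℂ)
  else if n ≤ 0 then (1 - (n : ℂ)) • time x₀ 1 (1 - n).toNat else 0

/-- The Orlov–Schulman operator `M₁ = W₁ (s Λ⁻¹ + ∑ k x^{(1)}_k Λ^{k-1}) W₁⁻¹`. -/
def M₁ (x₀ : Fin 2 × ℕ+ →₀ ℂ) (w₁ : ℕ → ℝ → TimeSeries) : DiffOp :=
  lowerOp w₁ ⋆ bareM₁ x₀ ⋆ lowerOp (invCoeff (-1) w₁)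

/-- The Orlov–Schulman operator `M₂ = W₂ (-s Λ + ∑ k x^{(2)}_k Λ^{1-k}) W₂⁻¹`. -/
def M₂ (x₀ : Fin 2 × ℕ+ →₀ ℂ) (w₂ : ℕ → ℝ → TimeSeries) : DiffOp :=
  upperOp w₂ ⋆ bareM₂ x₀ ⋆ upperOp (invCoeff 1 w₂)

/-! ### The hierarchy and its Virasoro symmetries -/

/-- `W₁ = ∑ w₁ᵢ Λ⁻ⁱ` and `W₂ = ∑ w₂ᵢ Λⁱ` are dressing operators of a solution of the modified
Toda hierarchy. -/
structure IsModifiedToda (w₁ w₂ : ℕ → ℝ → TimeSeries) : Prop where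
  w₁_ne : ∀ s, MvPowerSeries.constantCoeff (w₁ 0 s) ≠ 0
  w₂_ne : ∀ s, MvPowerSeries.constantCoeff (w₂ 0 s) ≠ 0
  flow₁₁ : ∀ k : ℕ, 1 ≤ k →
    (lowerOp w₁).deriv 0 k = -((L₁pow w₁ k).deltaNonpos ⋆ lowerOp w₁)
  flow₁₂ : ∀ k : ℕ, 1 ≤ k →
    (upperOp w₂).deriv 0 k = (L₁pow w₁ k).deltaPos ⋆ upperOp w₂
  flow₂₁ : ∀ k : ℕ, 1 ≤ k →
    (lowerOp w₁).deriv 1 k = (L₂pow w₂ k).deltaStarPos ⋆ lowerOp w₁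
  flow₂₂ : ∀ k : ℕ, 1 ≤ k →
    (upperOp w₂).deriv 1 k = -((L₂pow w₂ k).deltaStarNonpos ⋆ upperOp w₂)

/-- The `(N, M)`-bigraded reduction: `L₁ᴺ = L₂ᴹ` and `(L₁ᴺ + L₂ᴹ)(1) = 0`. -/
structure IsBigradedModifiedToda (N M : ℕ) (w₁ w₂ : ℕ → ℝ → TimeSeries) : Prop
    extends IsModifiedToda w₁ w₂ where
  pow_eq : L₁pow w₁ N = L₂pow w₂ M
  apply_one : (L₁pow w₁ N + L₂pow w₂ M).apply (fun _ => 1) = 0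

/-- `∂W₁/∂s_l = ((1/M) (M₂ L₂^{Ml+1})_{Δ*,≥1} - (1/N) (M₁ L₁^{Nl+1})_{Δ,≤0}) W₁`. -/
def virasoroW₁ (x₀ : Fin 2 × ℕ+ →₀ ℂ) (N M : ℕ) (w₁ w₂ : ℕ → ℝ → TimeSeries) (l : ℤ) :
    DiffOp :=
  ((1 / M : ℂ) • (M₂ x₀ w₂ ⋆ L₂pow w₂ (M * l + 1)).deltaStarPos -
    (1 / N : ℂ) • (M₁ x₀ w₁ ⋆ L₁pow w₁ (N * l + 1)).deltaNonpos) ⋆ lowerOp w₁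

/-- `∂W₂/∂s_l = ((1/N) (M₁ L₁^{Nl+1})_{Δ,≥1} - (1/M) (M₂ L₂^{Ml+1})_{Δ*,≤0}) W₂`. -/
def virasoroW₂ (x₀ : Fin 2 × ℕ+ →₀ ℂ) (N M : ℕ) (w₁ w₂ : ℕ → ℝ → TimeSeries) (l : ℤ) :
    DiffOp :=
  ((1 / N : ℂ) • (M₁ x₀ w₁ ⋆ L₁pow w₁ (N * l + 1)).deltaPos -
    (1 / M : ℂ) • (M₂ x₀ w₂ ⋆ L₂pow w₂ (M * l + 1)).deltaStarNonpos) ⋆ upperOp w₂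

/-! ### Tau functions -/

/-- The coefficient of `uⁿ` in `exp a = ∑ⱼ aʲ / j!`, for `a` without constant term (the terms with
`j > n` do not contribute). -/
def expCoeff {A : Type} [Ring A] [Algebra ℂ A] (a : PowerSeries A) (n : ℕ) : A :=
  ∑ j ∈ range (n + 1), (1 / (j.factorial : ℂ)) • PowerSeries.coeff n (a ^ j)

/-- The coefficient of `uⁿ` in `exp (-∑_{i ≥ 1} (∂ / ∂x^{(a+1)}_i) uⁱ / i)`.  With `u = z⁻¹` these
are the coefficients of `G₁(z)` (`a = 0`), with `u = z` those of `G₂(z)` (`a = 1`). -/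
def G (a : Fin 2) (n : ℕ) : Module.End ℂ TimeSeries :=
  expCoeff (PowerSeries.mk fun i => (-(1 / (i : ℂ))) • timeDeriv a i) n

/-- `τ₀, τ₁` are tau functions of the wave functions `ψ₁ = W₁ e^{ξ(x^{(1)},Λ)}(zˢ)` and
`ψ₂ = W₂ e^{ξ(x^{(2)},Λ⁻¹)}(zˢ)`:
`ψ₁ = (G₁(z)τ₀(s) / τ₁(s)) zˢ e^{ξ(x^{(1)},z)}`, `ψ₂ = (G₂(z)τ₀(s+1) / τ₁(s)) zˢ e^{ξ(x^{(2)},1/z)}`.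
As `ψ₁ = (∑ w₁ᵢ z⁻ⁱ) zˢ e^{ξ(x^{(1)},z)}` and `ψ₂ = (∑ w₂ᵢ zⁱ) zˢ e^{ξ(x^{(2)},1/z)}`, this is a
comparison of the coefficients of `z⁻ⁱ` and of `zⁱ`. -/
structure IsTauPair (w₁ w₂ : ℕ → ℝ → TimeSeries) (τ₀ τ₁ : ℝ → TimeSeries) : Prop where
  τ₀_ne : ∀ s, MvPowerSeries.constantCoeff (τ₀ s) ≠ 0
  τ₁_ne : ∀ s, MvPowerSeries.constantCoeff (τ₁ s) ≠ 0
  wave₁ : ∀ i s, w₁ i s = G 0 i (τ₀ s) * (τ₁ s)⁻¹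
  wave₂ : ∀ i s, w₂ i s = G 1 i (τ₀ (s + 1)) * (τ₁ s)⁻¹

/-- The infinitesimal change `(δτ₀, δτ₁)` of the tau functions induces the infinitesimal change
`(δW₁, δW₂)` of the dressing operators (equivalently, of the wave functions): the linearization
at `(W₁, W₂, τ₀, τ₁)` of `w₁ᵢ τ₁ = G₁,ᵢ τ₀` and `w₂ᵢ τ₁ = G₂,ᵢ Λτ₀`, together with the fact that
`δW₁`, `δW₂` have no powers `Λⁱ` with `i > 0`, resp. `i < 0`. -/
structure Induces (w₁ w₂ : ℕ → ℝ → TimeSeries) (τ₀ τ₁ : ℝ → TimeSeries)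
    (δτ₀ δτ₁ : ℝ → TimeSeries) (δW₁ δW₂ : DiffOp) : Prop where
  lower : ∀ (i : ℤ) s, 0 < i → δW₁ i s = 0
  upper : ∀ (i : ℤ) s, i < 0 → δW₂ i s = 0
  wave₁ : ∀ (i : ℕ) s, δW₁ (-i) s * τ₁ s + w₁ i s * δτ₁ s = G 0 i (δτ₀ s)
  wave₂ : ∀ (i : ℕ) s, δW₂ i s * τ₁ s + w₂ i s * δτ₁ s = G 1 i (δτ₀ (s + 1))

/-! ### The operators `W_{s,l,m}`

They are the coefficients of `𝕏(λ,μ) = (μ/λ)ᵉ X(λ,μ) = ∑ₘ (μ-λ)ᵐ/m! ∑ₗ λ^{-m-l} W_{l,m}`, where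
`X(λ,μ) = e^{ξ(x,μ)-ξ(x,λ)} e^{ξ(∂̃,λ⁻¹)-ξ(∂̃,μ⁻¹)}`, `∂̃ = (∂₁, ∂₂/2, ∂₃/3, …)`.  In the variables
`λ` and `u = (μ-λ)/λ`, so that `μ = λ(1+u)`, this reads
`(1+u)ᵉ X = ∑_{m,l} (uᵐ/m!) λ⁻ˡ W_{l,m}`. -/

/-- The coefficient of `uᵐ λʳ` in `e^{ξ(x,μ)-ξ(x,λ)} = exp (∑ₖ x_k λᵏ ((1+u)ᵏ - 1))`. -/
def vertexMul (x₀ : Fin 2 × ℕ+ →₀ ℂ) (a : Fin 2) (m r : ℕ) : TimeSeries :=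
  PowerSeries.coeff r (expCoeff (PowerSeries.mk fun n => PowerSeries.mk fun k =>
    if n = 0 then 0 else (Nat.choose k n : ℂ) • time x₀ a k) m)

/-- The coefficient of `uᵐ λ⁻ʳ` in
`e^{ξ(∂̃,λ⁻¹)-ξ(∂̃,μ⁻¹)} = exp (∑ₖ (∂ₖ/k) λ⁻ᵏ (1 - (1+u)⁻ᵏ))`. -/
def vertexDeriv (a : Fin 2) (m r : ℕ) : Module.End ℂ TimeSeries :=
  PowerSeries.coeff r (expCoeff (PowerSeries.mk fun n => PowerSeries.mk fun k =>
    if n = 0 then 0 else (-(Ring.choose (-(k : ℤ)) n : ℂ) / (k : ℂ)) • timeDeriv a k) m)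

/-- `m!` times the coefficient of `uᵐ λ⁻ˡ` in `(1+u)ᵉ X(λ,μ)`, applied to `f`. -/
def vertexMode (x₀ : Fin 2 × ℕ+ →₀ ℂ) (a : Fin 2) (e : ℝ) (l : ℤ) (m : ℕ) (f : TimeSeries) :
    TimeSeries :=
  (m.factorial : ℂ) • ∑ i ∈ range (m + 1), ((Ring.choose e i : ℝ) : ℂ) •
    ∑ p ∈ antidiagonal (m - i), lsum fun r : ℕ =>
      if 0 ≤ l + r then vertexMul x₀ a p.1 r * vertexDeriv a p.2 (l + r).toNat f else 0

/-- `W^{(1)}_{s,l,m}`, from `𝕏₁(λ,μ) = (μ/λ)ˢ X₁(λ,μ)`. -/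
def Wgen₁ (x₀ : Fin 2 × ℕ+ →₀ ℂ) (s : ℝ) (l : ℤ) (m : ℕ) : TimeSeries → TimeSeries :=
  vertexMode x₀ 0 s l m

/-- `W^{(2)}_{s,l,m}`, from `𝕏₂(λ,μ) = (λ/μ)ˢ X₂(λ,μ)`. -/
def Wgen₂ (x₀ : Fin 2 × ℕ+ →₀ ℂ) (s : ℝ) (l : ℤ) (m : ℕ) : TimeSeries → TimeSeries :=
  vertexMode x₀ 1 (-s) l m

/-- `½ ((1/N) W^{(1)}_{s,Nl,2} + (1/M) W^{(2)}_{s-1,Ml,2}) τ₀(s)`. -/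
def virasoroτ₀ (x₀ : Fin 2 × ℕ+ →₀ ℂ) (N M : ℕ) (l : ℤ) (τ₀ : ℝ → TimeSeries) :
    ℝ → TimeSeries := fun s =>
  (1 / 2 : ℂ) • ((1 / N : ℂ) • Wgen₁ x₀ s (N * l) 2 (τ₀ s) +
    (1 / M : ℂ) • Wgen₂ x₀ (s - 1) (M * l) 2 (τ₀ s))

/-- `½ ((1/N) W^{(1)}_{s+1,Nl,2} + (1/M) W^{(2)}_{s-1,Ml,2}) τ₁(s)`. -/
def virasoroτ₁ (x₀ : Fin 2 × ℕ+ →₀ ℂ) (N M : ℕ) (l : ℤ) (τ₁ : ℝ → TimeSeries) :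
    ℝ → TimeSeries := fun s =>
  (1 / 2 : ℂ) • ((1 / N : ℂ) • Wgen₁ x₀ (s + 1) (N * l) 2 (τ₁ s) +
    (1 / M : ℂ) • Wgen₂ x₀ (s - 1) (M * l) 2 (τ₁ s))

end BMTH

end

open BMTH

noncomputable section

namespace BMTH

open DiffOp

/-! ### Locally finite families of power series -/

/-! The substitution `Λ ↔ Λ⁻¹`, `s ↦ -s` exchanges the two sets of times, so all the work is done
for one of them (`IsHalfSolution`). With `B_q = (L^q)_{Δ,≥1}` the flows read `∂_q W = B_q W - W Λ^q`
for the lower dressing operator and `∂_q W' = B_q W'` for the upper one; `HasFlow` covers both, with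
`ε = 1` and `ε = 0`.

Half of the vertex mode of order two is an explicit second order differential operator `Q_k` in the
times (`half_smul_vertexMode_two`). On the other side, `M L^{k+1} = ∑ c_q L^q` with functions `c_q`
built from `s`, the times and the logarithmic derivative `v = z∂_z log w(z)` of `w(z) = ∑ wᵢ z⁻ⁱ`
(`orlov_expansion`). Projection to positive powers of `Δ` commutes with left multiplication by
functions, so `(M L^{k+1})_{Δ,≥1}` acts on `W'` as the first order operator `∑ c_q ∂_q`. The terms
of `c_q` with `s` and the times give first order terms of `Q_k`; the terms `∑ v_j ∂_{k-j}` have to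
account for the second order part.

This is the content of `second_order_identity`. Combine the operators `∂_i B_j + B_j B_i` (`i + j =
k`), `B_i` and `B_k` into an operator `D`, with coefficients `f_j = v_j - ∂_jτ₁/τ₁`. It is a
polynomial in `Λ` and annihilates `1`. The recursion `n G_n = -∑ ∂_j G_{n-j}`, that is, `z∂_z`
applied to `G(z)τ₀ = w(z)τ₁`, shows that `D W` has no positive powers of `Λ`. Hence neither has `D =
D W W⁻¹`, and `D = 0` (`secondOrderOp_eq_zero`). Reading `D W = 0` and `D W' = 0` coefficientwise
gives the identity.

After multiplication by `τ₁`, the Leibniz rule for `Q_k` (`quadMode_mul`) and its commutation with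
`G` (`GZ_quadMode`, `GZ_quadMode_of_ne`) yield `induces_upper_aux` and `induces_lower_aux`; the two
halves add up to `induces_virasoro`.

For uniqueness, the difference of two admissible changes is `(cτ₀, cτ₁)` with `c(s+1) = c(s)`, by
the leading coefficients. The other coefficients say that every `G_i` commutes with multiplication
by `c` on `τ₀`, which forces all time derivatives of `c` to vanish. -/

/-- A family of power series each of whose coefficients has only finitely many nonzero terms. -/
def LocFin {ι : Type} (f : ι → TimeSeries) : Prop :=
  ∀ γ, (Function.support fun i => MvPowerSeries.coeff γ (f i)).Finite

section LocFin

variable {ι κ : Type}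

theorem coeff_lsum (f : ι → TimeSeries) (γ : Fin 2 × ℕ+ →₀ ℕ) :
    MvPowerSeries.coeff γ (lsum f) = ∑ᶠ i, MvPowerSeries.coeff γ (f i) := rfl

theorem LocFin.of_support {f : ι → TimeSeries} (S : Set ι) (hS : S.Finite)
    (h : ∀ i, i ∉ S → f i = 0) : LocFin f := fun γ =>
  hS.subset fun i hi => by
    by_contra hn
    exact hi (by simp [h i hn])

theorem LocFin.of_Icc {f : ℤ → TimeSeries} (m n : ℤ) (h : ∀ i, i < m ∨ n < i → f i = 0) :
    LocFin f :=
  .of_support (Set.Icc m n) (Set.finite_Icc m n) fun i hi => h i (by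
    simp only [Set.mem_Icc, not_and_or, not_le] at hi; exact hi)

theorem LocFin.add {f g : ι → TimeSeries} (hf : LocFin f) (hg : LocFin g) :
    LocFin fun i => f i + g i := fun γ =>
  ((hf γ).union (hg γ)).subset fun i hi => by
    simp only [Function.mem_support, map_add, Set.mem_union] at hi ⊢
    by_contra! hn
    exact hi (by simp [hn])

theorem LocFin.neg {f : ι → TimeSeries} (hf : LocFin f) : LocFin fun i => - f i := fun γ =>
  (hf γ).subset fun i hi => by simpa using hi

theorem LocFin.smul {f : ι → TimeSeries} (c : ℂ) (hf : LocFin f) : LocFin fun i => c • f i :=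
  fun γ => (hf γ).subset fun i hi => by
    simp only [Function.mem_support, map_smul, smul_eq_mul] at hi ⊢
    exact right_ne_zero_of_mul hi

/-- No condition on `g` is needed: the coefficient at `γ` of a product involves only the finitely
many coefficients of `f i` at divisors of `γ`. -/
theorem LocFin.mul_left {f : ι → TimeSeries} (g : ι → TimeSeries) (hf : LocFin f) :
    LocFin fun i => g i * f i := fun γ => by
  refine ((antidiagonal γ).finite_toSet.biUnion (t := fun p =>
    Function.support fun i => MvPowerSeries.coeff p.2 (f i)) fun p _ => hf p.2).subset ?_
  intro i hi
  simp only [Function.mem_support, MvPowerSeries.coeff_mul] at hi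
  obtain ⟨p, hp, h⟩ := exists_ne_zero_of_sum_ne_zero hi
  exact Set.mem_biUnion hp (right_ne_zero_of_mul h)

theorem LocFin.mul_right {f : ι → TimeSeries} (g : ι → TimeSeries) (hf : LocFin f) :
    LocFin fun i => f i * g i := by
  simpa only [mul_comm] using hf.mul_left g

theorem LocFin.comp_injective {f : ι → TimeSeries} (hf : LocFin f) {e : κ → ι}
    (he : Function.Injective e) : LocFin fun k => f (e k) := fun γ =>
  (hf γ).preimage he.injOn

theorem LocFin.of_prod_right {f : ι → κ → TimeSeries} (hf : LocFin fun p : ι × κ => f p.1 p.2)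
    (i : ι) : LocFin fun k => f i k :=
  hf.comp_injective (e := fun k => (i, k)) fun _ _ h => (Prod.mk.inj h).2

theorem lsum_add {f g : ι → TimeSeries} (hf : LocFin f) (hg : LocFin g) :
    lsum (fun i => f i + g i) = lsum f + lsum g := by
  ext γ
  simp only [coeff_lsum, map_add]
  exact finsum_add_distrib (hf γ) (hg γ)

theorem lsum_neg (f : ι → TimeSeries) : lsum (fun i => - f i) = - lsum f := by
  ext γ
  simp only [coeff_lsum, map_neg]
  exact finsum_neg_distrib _

theorem lsum_sub {f g : ι → TimeSeries} (hf : LocFin f) (hg : LocFin g) :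
    lsum (fun i => f i - g i) = lsum f - lsum g := by
  simp only [sub_eq_add_neg]
  rw [lsum_add hf hg.neg, lsum_neg]

theorem lsum_smul (c : ℂ) (f : ι → TimeSeries) : lsum (fun i => c • f i) = c • lsum f := by
  ext γ
  simp only [coeff_lsum, map_smul]
  exact (smul_finsum c _).symm

@[simp] theorem lsum_zero : lsum (fun _ : ι => (0 : TimeSeries)) = 0 := by
  ext γ
  simp [coeff_lsum]

theorem lsum_mul_left (g : TimeSeries) {f : ι → TimeSeries} (hf : LocFin f) :
    lsum (fun i => g * f i) = g * lsum f := by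
  ext γ
  simp only [coeff_lsum, MvPowerSeries.coeff_mul]
  rw [finsum_sum_comm]
  · exact sum_congr rfl fun p _ => (mul_finsum _ _).symm
  · intro p _
    exact (hf p.2).subset fun i hi => right_ne_zero_of_mul hi

theorem lsum_mul_right (g : TimeSeries) {f : ι → TimeSeries} (hf : LocFin f) :
    lsum (fun i => f i * g) = lsum f * g := by
  simpa only [mul_comm] using lsum_mul_left g hf

theorem lsum_comp_equiv (e : κ ≃ ι) (f : ι → TimeSeries) : lsum (fun k => f (e k)) = lsum f := by
  ext γ
  exact finsum_comp_equiv (f := fun i => MvPowerSeries.coeff γ (f i)) e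

theorem lsum_comm {f : ι → κ → TimeSeries} (hf : LocFin fun p : ι × κ => f p.1 p.2) :
    lsum (fun i => lsum (f i)) = lsum fun k => lsum fun i => f i k := by
  ext γ
  simp only [coeff_lsum]
  rw [← finsum_curry (fun p : ι × κ => MvPowerSeries.coeff γ (f p.1 p.2)) (hf γ),
    ← finsum_comp_equiv (Equiv.prodComm κ ι)]
  exact finsum_curry (fun p : κ × ι => MvPowerSeries.coeff γ (f p.2 p.1))
      ((hf γ).preimage (Equiv.prodComm κ ι).injective.injOn)

theorem lsum_eq_sum {f : ι → TimeSeries} (S : Finset ι) (h : ∀ i, i ∉ S → f i = 0) :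
    lsum f = ∑ i ∈ S, f i := by
  ext γ
  rw [coeff_lsum, map_sum]
  refine finsum_eq_sum_of_support_subset _ fun i hi => ?_
  by_contra hn
  exact hi (by simp [h i hn])

theorem lsum_eq_single {f : ι → TimeSeries} (i : ι) (h : ∀ j, j ≠ i → f j = 0) :
    lsum f = f i := by
  classical
  rw [lsum_eq_sum {i} (fun j hj => h j (by simpa using hj)), sum_singleton]

theorem lsum_eq_zero {f : ι → TimeSeries} (h : ∀ j, f j = 0) : lsum f = 0 := by
  rw [funext h]; exact lsum_zero

theorem lsum_finset_sum {f : κ → ι → TimeSeries} (S : Finset κ) (hf : ∀ k ∈ S, LocFin (f k)) :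
    lsum (fun i => ∑ k ∈ S, f k i) = ∑ k ∈ S, lsum (f k) := by
  ext γ
  simp only [coeff_lsum, map_sum]
  exact finsum_sum_comm _ _ fun k hk => hf k hk γ

/-- A sum over `ℤ` whose terms of index less than `m` vanish. -/
theorem lsum_int_eq_nat (m : ℤ) {f : ℤ → TimeSeries} (h : ∀ q, q < m → f q = 0) :
    lsum f = lsum fun n : ℕ => f (m + n) := by
  classical
  ext γ
  simp only [coeff_lsum]
  have e : (fun n : ℕ => MvPowerSeries.coeff γ (f (m + n))) =
      fun n : ℕ => (fun q => MvPowerSeries.coeff γ (f q)) ((fun n : ℕ => m + (n : ℤ)) n) := rfl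
  have hinj : Function.Injective fun n : ℕ => m + (n : ℤ) := fun a b hab => by simpa using hab
  rw [e, ← finsum_mem_range (f := fun q => MvPowerSeries.coeff γ (f q)) hinj]
  refine finsum_congr fun q => ?_
  by_cases hq : q < m
  · simp [h q hq]
  · rw [finsum_eq_if, if_pos ⟨(q - m).toNat, by simp; omega⟩]

end LocFin

/-! ### Linear maps compatible with locally finite sums -/

/-- The linear maps that commute with locally finite sums. -/
def lsumMaps : Subalgebra ℂ (Module.End ℂ TimeSeries) where
  carrier := {T | ∀ (ι : Type) (f : ι → TimeSeries), LocFin f →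
    LocFin (fun i => T (f i)) ∧ T (lsum f) = lsum fun i => T (f i)}
  mul_mem' {S T} hS hT ι f hf := by
    obtain ⟨h, e⟩ := hT ι f hf
    obtain ⟨h', e'⟩ := hS ι _ h
    exact ⟨h', by simp only [Module.End.mul_apply, e, e']⟩
  add_mem' {S T} hS hT ι f hf := by
    obtain ⟨h, e⟩ := hT ι f hf
    obtain ⟨h', e'⟩ := hS ι f hf
    exact ⟨h'.add h, by simp only [LinearMap.add_apply, e, e', lsum_add h' h]⟩
  algebraMap_mem' c ι f hf :=
    ⟨by simpa [Module.algebraMap_end_apply] using hf.smul c,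
      by simp [Module.algebraMap_end_apply, lsum_smul]⟩

theorem mem_lsumMaps {T : Module.End ℂ TimeSeries} : T ∈ lsumMaps ↔
    ∀ (ι : Type) (f : ι → TimeSeries), LocFin f →
      LocFin (fun i => T (f i)) ∧ T (lsum f) = lsum fun i => T (f i) := Iff.rfl

theorem timeDeriv_zero (a : Fin 2) : timeDeriv a 0 = 0 := by simp [timeDeriv]

theorem timeDeriv_pnat (a : Fin 2) (k : ℕ+) (f : TimeSeries) :
    timeDeriv a k f = MvPowerSeries.pderiv ℂ (a, k) f := by
  unfold timeDeriv
  rw [dif_pos k.pos]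
  rfl

theorem time_zero (x₀ : Fin 2 × ℕ+ →₀ ℂ) (a : Fin 2) : time x₀ a 0 = 0 := by simp [time]

theorem time_pnat (x₀ : Fin 2 × ℕ+ →₀ ℂ) (a : Fin 2) (k : ℕ+) :
    time x₀ a k = MvPowerSeries.C (x₀ (a, k)) + MvPowerSeries.X (a, k) := by
  unfold time
  rw [dif_pos k.pos]
  rfl

theorem eq_zero_or_eq_pnat (k : ℕ) : k = 0 ∨ ∃ p : ℕ+, k = p :=
  k.eq_zero_or_pos.imp_right fun h => ⟨⟨k, h⟩, rfl⟩

/-- Each coefficient of a derivative is a multiple of a single coefficient of the function. -/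
theorem timeDeriv_mem_lsumMaps (a : Fin 2) (k : ℕ) : timeDeriv a k ∈ lsumMaps := by
  obtain rfl | ⟨k, rfl⟩ := eq_zero_or_eq_pnat k
  · rw [timeDeriv_zero]
    exact zero_mem _
  · refine mem_lsumMaps.2 fun ι f hf => ⟨fun γ => ?_, ?_⟩
    · refine (hf (γ + Finsupp.single (a, k) 1)).subset fun i hi => ?_
      simp only [timeDeriv_pnat, Function.mem_support, MvPowerSeries.coeff_pderiv] at hi
      exact left_ne_zero_of_mul hi
    · ext γ
      simp only [timeDeriv_pnat, MvPowerSeries.coeff_pderiv, coeff_lsum]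
      exact finsum_mul _ _

/-! ### Derivations with respect to the times -/

theorem timeDeriv_mul (a : Fin 2) (k : ℕ) (f g : TimeSeries) :
    timeDeriv a k (f * g) = timeDeriv a k f * g + f * timeDeriv a k g := by
  unfold timeDeriv
  split_ifs
  · simp [add_comm, mul_comm]
  · simp

theorem timeDeriv_comm (a b : Fin 2) (j k : ℕ) (f : TimeSeries) :
    timeDeriv a j (timeDeriv b k f) = timeDeriv b k (timeDeriv a j f) := by
  classical
  obtain rfl | ⟨j, rfl⟩ := eq_zero_or_eq_pnat j
  · simp [timeDeriv_zero]
  obtain rfl | ⟨k, rfl⟩ := eq_zero_or_eq_pnat k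
  · simp [timeDeriv_zero]
  ext γ
  simp only [timeDeriv_pnat, MvPowerSeries.coeff_pderiv]
  by_cases e : (a, j) = (b, k)
  · rw [e]
  · simp only [Finsupp.add_apply, Finsupp.single_apply, if_neg e, if_neg (Ne.symm e),
      add_zero, add_right_comm _ (Finsupp.single (a, j) 1)]
    ring

theorem timeDeriv_time (x₀ : Fin 2 × ℕ+ →₀ ℂ) (a b : Fin 2) (j k : ℕ) :
    timeDeriv a j (time x₀ b k) = if a = b ∧ j = k ∧ 0 < k then 1 else 0 := by
  classical
  obtain rfl | ⟨k, rfl⟩ := eq_zero_or_eq_pnat k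
  · simp [time_zero]
  obtain rfl | ⟨j, rfl⟩ := eq_zero_or_eq_pnat j
  · rw [timeDeriv_zero, if_neg (by have := k.pos; omega)]
    rfl
  rw [timeDeriv_pnat, time_pnat, map_add, MvPowerSeries.pderiv_C, zero_add]
  by_cases e : a = b ∧ j = k
  · obtain ⟨rfl, rfl⟩ := e
    simp
  · rw [if_neg (by simpa using e), MvPowerSeries.pderiv_X_of_ne]
    intro h
    simp only [Prod.mk.injEq] at h
    exact e ⟨h.1.symm, h.2.symm⟩

/-- The coefficients of order at most `γ` vanish. -/
def VanishesTo (γ : Fin 2 × ℕ+ →₀ ℕ) (f : TimeSeries) : Prop :=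
  ∀ γ' ≤ γ, MvPowerSeries.coeff γ' f = 0

theorem VanishesTo.mul_left {γ : Fin 2 × ℕ+ →₀ ℕ} {f : TimeSeries} (h : VanishesTo γ f)
    (g : TimeSeries) : VanishesTo γ (g * f) := fun γ' hγ => by
  rw [MvPowerSeries.coeff_mul]
  refine sum_eq_zero fun p hp => ?_
  rw [h p.2 ((le_of_le_of_eq le_add_self (mem_antidiagonal.1 hp)).trans hγ), mul_zero]

theorem VanishesTo.mul_right {γ : Fin 2 × ℕ+ →₀ ℕ} {f : TimeSeries} (h : VanishesTo γ f)
    (g : TimeSeries) : VanishesTo γ (f * g) := mul_comm g f ▸ h.mul_left g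

theorem VanishesTo.smul {γ : Fin 2 × ℕ+ →₀ ℕ} {f : TimeSeries} (h : VanishesTo γ f)
    (c : ℂ) : VanishesTo γ (c • f) := fun γ' hγ => by simp [h γ' hγ]

theorem VanishesTo.add {γ : Fin 2 × ℕ+ →₀ ℕ} {f g : TimeSeries} (hf : VanishesTo γ f)
    (hg : VanishesTo γ g) : VanishesTo γ (f + g) := fun γ' hγ => by simp [hf γ' hγ, hg γ' hγ]

theorem VanishesTo.lsum {ι : Type} {γ : Fin 2 × ℕ+ →₀ ℕ} {f : ι → TimeSeries}
    (h : ∀ i, VanishesTo γ (f i)) : VanishesTo γ (lsum f) := fun γ' hγ => by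
  rw [coeff_lsum]
  exact finsum_eq_zero_of_forall_eq_zero fun i => h i γ' hγ

theorem vanishesTo_zero (γ : Fin 2 × ℕ+ →₀ ℕ) : VanishesTo γ 0 := fun γ' _ => by simp

/-- This makes the infinite sums over the times meaningful: since `x₀` has finite support, for large
`k` the time is just the variable `X (a, k)`, which does not divide the monomial `γ`. -/
theorem exists_time_vanishesTo (x₀ : Fin 2 × ℕ+ →₀ ℂ) (a : Fin 2) (γ : Fin 2 × ℕ+ →₀ ℕ) :
    ∃ K : ℕ, ∀ k, K < k → VanishesTo γ (time x₀ a k) := by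
  classical
  refine ⟨(x₀.support ∪ γ.support).sup fun p => (p.2 : ℕ), fun k hk γ' hγ => ?_⟩
  obtain rfl | ⟨k, rfl⟩ := eq_zero_or_eq_pnat k
  · simp [time_zero]
  have hn : (a, k) ∉ x₀.support ∪ γ.support := fun hm =>
    absurd (le_sup (f := fun p : Fin 2 × ℕ+ => (p.2 : ℕ)) hm) (not_le.2 hk)
  simp only [mem_union, Finsupp.mem_support_iff, not_or, not_not] at hn
  rw [time_pnat, hn.1, map_zero, zero_add, MvPowerSeries.coeff_X, if_neg]
  rintro rfl
  have := hγ (a, k)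
  simp [hn.2] at this

theorem locFin_time (x₀ : Fin 2 × ℕ+ →₀ ℂ) (a : Fin 2) : LocFin fun k : ℕ => time x₀ a k := by
  intro γ
  obtain ⟨K, hK⟩ := exists_time_vanishesTo x₀ a γ
  refine (Set.finite_Iic K).subset fun k hk => ?_
  by_contra hn
  exact hk (hK k (not_le.1 hn) γ le_rfl)

/-! ### Products of difference operators -/

namespace DiffOp

theorem mul_apply (A B : DiffOp) (n : ℤ) (s : ℝ) :
    (A ⋆ B) n s = lsum fun i : ℤ => A i s * B (n - i) (s + i) := rfl

/-- All the sums in the coefficients of `A ⋆ B` are locally finite. -/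
def Composable (A B : DiffOp) : Prop :=
  ∀ (n : ℤ) (s : ℝ), LocFin fun i : ℤ => A i s * B (n - i) (s + i)

theorem mul_assoc_of_locFin {A B C : DiffOp} (hAB : Composable A B) (hBC : Composable B C)
    (h : ∀ (n : ℤ) (s : ℝ), LocFin fun p : ℤ × ℤ =>
      A p.1 s * (B p.2 (s + p.1) * C (n - p.1 - p.2) (s + p.1 + p.2))) :
    A ⋆ B ⋆ C = A ⋆ (B ⋆ C) := by
  funext n s
  simp only [mul_apply]
  -- The double sum in `(A ⋆ B) ⋆ C` runs over the total exponent `i` and the exponent `j` of `A`;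
  -- the exponent of `B` is `i - j`.
  have hinj : Function.Injective fun p : ℤ × ℤ => (p.2, p.1 - p.2) := fun p q hpq => by
    simp only [Prod.mk.injEq] at hpq
    exact Prod.ext (by omega) hpq.1
  have h' := (h n s).comp_injective hinj
  calc lsum (fun i : ℤ => lsum (fun j : ℤ => A j s * B (i - j) (s + j)) * C (n - i) (s + i))
      = lsum fun i : ℤ => lsum fun j : ℤ =>
          A j s * (B (i - j) (s + j) * C (n - j - (i - j)) (s + j + (i - j : ℤ))) := by
        congr 1
        funext i
        rw [← lsum_mul_right _ (hAB i s)]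
        congr 1
        funext j
        have e1 : n - j - (i - j) = n - i := by ring
        have e2 : s + (j : ℝ) + ((i - j : ℤ) : ℝ) = s + i := by push_cast; ring
        rw [mul_assoc, e1, e2]
    _ = lsum fun j : ℤ => lsum fun i : ℤ =>
          A j s * (B (i - j) (s + j) * C (n - j - (i - j)) (s + j + (i - j : ℤ))) :=
        lsum_comm h'
    _ = _ := by
        congr 1
        funext j
        rw [← lsum_mul_left _ (hBC (n - j) (s + j))]
        exact lsum_comp_equiv (Equiv.subRight j) fun i : ℤ =>
          A j s * (B i (s + j) * C (n - j - i) (s + j + i))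

theorem mul_shift (A : DiffOp) (p n : ℤ) (s : ℝ) : (A ⋆ shift p) n s = A (n - p) s := by
  rw [mul_apply, lsum_eq_single (n - p)]
  · simp [shift]
  · intro j hj
    rw [shift, if_neg (by omega), mul_zero]

theorem shift_zero_mul (A : DiffOp) : shift 0 ⋆ A = A := by
  funext n s
  rw [mul_apply, lsum_eq_single 0]
  · simp [shift]
  · intro j hj
    rw [shift, if_neg hj, zero_mul]

theorem mul_shift_zero (A : DiffOp) : A ⋆ shift 0 = A := by
  funext n s
  rw [mul_shift, sub_zero]

/-! ### Classes of operators whose products exist and associate -/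

/-- The coefficients of high powers of `Λ` vanish to any given order, uniformly in `s`. -/
def Tame (A : DiffOp) : Prop :=
  ∀ γ, ∃ K : ℤ, ∀ n, K < n → ∀ s, VanishesTo γ (A n s)

theorem Tame.of_bounded {A : DiffOp} (K : ℤ) (h : ∀ n s, K < n → A n s = 0) : Tame A :=
  fun γ => ⟨K, fun n hn s => by rw [h n s hn]; exact vanishesTo_zero γ⟩

theorem Tame.add {A B : DiffOp} (hA : Tame A) (hB : Tame B) : Tame (A + B) := fun γ => by
  obtain ⟨K, hK⟩ := hA γ
  obtain ⟨K', hK'⟩ := hB γ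
  exact ⟨max K K', fun n hn s => (hK n (by omega) s).add (hK' n (by omega) s)⟩

/-- To a given order both factors are bounded above in powers of `Λ`, so a fixed total power leaves
finitely many splittings. -/
theorem Tame.composable {A B : DiffOp} (hA : Tame A) (hB : Tame B) : Composable A B :=
  fun n s γ => by
    obtain ⟨K, hK⟩ := hA γ
    obtain ⟨K', hK'⟩ := hB γ
    refine (Set.finite_Icc (n - K') K).subset fun i hi => ?_
    by_contra hn
    simp only [Set.mem_Icc, not_and_or, not_le] at hn
    refine hi ?_
    obtain hn | hn := hn
    · exact (hK' (n - i) (by omega) (s + i)).mul_left _ γ le_rfl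
    · exact (hK i hn s).mul_right _ γ le_rfl

theorem Tame.mul {A B : DiffOp} (hA : Tame A) (hB : Tame B) : Tame (A ⋆ B) := fun γ => by
  obtain ⟨K, hK⟩ := hA γ
  obtain ⟨K', hK'⟩ := hB γ
  refine ⟨K + K', fun n hn s => VanishesTo.lsum fun i => ?_⟩
  by_cases hi : K < i
  · exact (hK i hi s).mul_right _
  · exact (hK' (n - i) (by omega) (s + i)).mul_left _

theorem Tame.mul_assoc {A B C : DiffOp} (hA : Tame A) (hB : Tame B) (hC : Tame C) :
    A ⋆ B ⋆ C = A ⋆ (B ⋆ C) := by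
  refine mul_assoc_of_locFin (hA.composable hB) (hB.composable hC) fun n s γ => ?_
  obtain ⟨K, hK⟩ := hA γ
  obtain ⟨K', hK'⟩ := hB γ
  obtain ⟨K'', hK''⟩ := hC γ
  refine ((Set.finite_Icc (n - K' - K'') K).prod (Set.finite_Icc (n - K - K'') K')).subset ?_
  intro p hp
  by_contra hn
  refine hp ?_
  by_cases h1 : K < p.1
  · exact (hK _ h1 s).mul_right _ γ le_rfl
  by_cases h2 : K' < p.2
  · exact ((hK' _ h2 _).mul_right _).mul_left _ γ le_rfl
  by_cases h3 : K'' < n - p.1 - p.2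
  · exact ((hK'' _ h3 _).mul_left _).mul_left _ γ le_rfl
  · exact absurd (by simp only [Set.mem_prod, Set.mem_Icc]; omega) hn

theorem tame_shift (p : ℤ) : Tame (shift p) :=
  .of_bounded p fun n s hn => if_neg (by omega)

/-- Only finitely many nonnegative powers of `Λ` occur. -/
def IsPoly (D : DiffOp) : Prop := ∃ K : ℤ, ∀ n s, n < 0 ∨ K < n → D n s = 0

theorem IsPoly.composable {D : DiffOp} (hD : IsPoly D) (A : DiffOp) : Composable D A :=
  fun n s => by
    obtain ⟨K, hK⟩ := hD
    exact .of_Icc 0 K fun i hi => by rw [hK i s hi, zero_mul]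

theorem IsPoly.tame {D : DiffOp} (hD : IsPoly D) : Tame D := by
  obtain ⟨K, hK⟩ := hD
  exact .of_bounded K fun n s hn => hK n s (.inr hn)

/-- The last factor is arbitrary, so that polynomial operators can be applied to the upper dressing
operator, which may be unbounded in powers of `Λ`. -/
theorem IsPoly.mul_assoc {D E : DiffOp} (hD : IsPoly D) (hE : IsPoly E) (A : DiffOp) :
    D ⋆ E ⋆ A = D ⋆ (E ⋆ A) := by
  refine mul_assoc_of_locFin (hD.composable E) (hE.composable A) fun n s => ?_
  obtain ⟨K, hK⟩ := hD
  obtain ⟨K', hK'⟩ := hE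
  refine .of_support (Set.Icc 0 K ×ˢ Set.Icc 0 K') ((Set.finite_Icc _ _).prod (Set.finite_Icc _ _))
    fun p hp => ?_
  simp only [Set.mem_prod, Set.mem_Icc, not_and_or, not_le] at hp
  obtain hp | hp := hp
  · rw [hK _ _ hp, zero_mul]
  · rw [hK' _ _ hp, zero_mul, mul_zero]

theorem deriv_mul_of_isPoly (a : Fin 2) (k : ℕ) {D : DiffOp} (hD : IsPoly D) (A : DiffOp) :
    (D ⋆ A).deriv a k = D.deriv a k ⋆ A + D ⋆ A.deriv a k := by
  funext n s
  have h := (mem_lsumMaps.1 (timeDeriv_mem_lsumMaps a k) _ _ (hD.composable A n s)).2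
  have hD' : IsPoly (D.deriv a k) := by
    obtain ⟨K, hK⟩ := hD
    exact ⟨K, fun n s hn => by rw [deriv, hK n s hn, map_zero]⟩
  change timeDeriv a k ((D ⋆ A) n s) = (D.deriv a k ⋆ A) n s + (D ⋆ A.deriv a k) n s
  simp only [mul_apply]
  rw [h, ← lsum_add (hD'.composable A n s) (hD.composable _ n s)]
  congr 1
  funext i
  exact timeDeriv_mul a k _ _

/-- A polynomial difference operator that annihilates the constants. -/
structure KillsOne (D : DiffOp) : Prop where
  isPoly : IsPoly D
  sum_eq_zero : ∀ s, lsum (fun n : ℤ => D n s) = 0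

theorem KillsOne.locFin {D : DiffOp} (hD : KillsOne D) (s : ℝ) : LocFin fun n : ℤ => D n s := by
  obtain ⟨K, hK⟩ := hD.isPoly
  exact .of_Icc 0 K fun n hn => hK n s hn

theorem KillsOne.add {D E : DiffOp} (hD : KillsOne D) (hE : KillsOne E) : KillsOne (D + E) where
  isPoly := by
    obtain ⟨K, hK⟩ := hD.isPoly
    obtain ⟨K', hK'⟩ := hE.isPoly
    refine ⟨max K K', fun n s hn => ?_⟩
    rw [Pi.add_apply, Pi.add_apply, hK n s (by omega), hK' n s (by omega), add_zero]
  sum_eq_zero s := by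
    simp only [Pi.add_apply]
    rw [lsum_add (hD.locFin s) (hE.locFin s), hD.sum_eq_zero, hE.sum_eq_zero, add_zero]

theorem KillsOne.mul_left {D : DiffOp} (f : ℝ → TimeSeries) (hD : KillsOne D) :
    KillsOne fun n s => f s * D n s where
  isPoly := by
    obtain ⟨K, hK⟩ := hD.isPoly
    exact ⟨K, fun n s hn => by simp only [hK n s hn, mul_zero]⟩
  sum_eq_zero s := by
    rw [lsum_mul_left _ (hD.locFin s), hD.sum_eq_zero, mul_zero]

theorem KillsOne.smul {D : DiffOp} (c : ℂ) (hD : KillsOne D) : KillsOne (c • D) := by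
  convert hD.mul_left fun _ => MvPowerSeries.C c using 1
  funext n s
  simp [MvPowerSeries.smul_eq_C_mul]

theorem killsOne_zero : KillsOne 0 where
  isPoly := ⟨0, fun _ _ _ => rfl⟩
  sum_eq_zero _ := lsum_zero

theorem KillsOne.sum {κ : Type} {D : κ → DiffOp} (S : Finset κ) (hD : ∀ k ∈ S, KillsOne (D k)) :
    KillsOne (∑ k ∈ S, D k) :=
  Finset.sum_induction _ KillsOne (fun _ _ => .add) killsOne_zero hD

theorem KillsOne.deriv {D : DiffOp} (a : Fin 2) (k : ℕ) (hD : KillsOne D) :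
    KillsOne (D.deriv a k) where
  isPoly := by
    obtain ⟨K, hK⟩ := hD.isPoly
    exact ⟨K, fun n s hn => by rw [DiffOp.deriv, hK n s hn, map_zero]⟩
  sum_eq_zero s := by
    have h := (mem_lsumMaps.1 (timeDeriv_mem_lsumMaps a k) _ _ (hD.locFin s)).2
    rw [hD.sum_eq_zero, map_zero] at h
    exact h.symm

theorem KillsOne.mul {D E : DiffOp} (hD : KillsOne D) (hE : KillsOne E) : KillsOne (D ⋆ E) where
  isPoly := by
    obtain ⟨K, hK⟩ := hD.isPoly
    obtain ⟨K', hK'⟩ := hE.isPoly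
    refine ⟨K + K', fun n s hn => lsum_eq_zero fun i => ?_⟩
    by_cases hi : i < 0 ∨ K < i
    · rw [hK _ _ hi, zero_mul]
    · rw [hK' _ _ (by omega), mul_zero]
  sum_eq_zero s := by
    obtain ⟨K, hK⟩ := hD.isPoly
    obtain ⟨K', hK'⟩ := hE.isPoly
    simp only [mul_apply]
    rw [lsum_comm]
    · refine lsum_eq_zero fun i => ?_
      have h := (hE.locFin (s + i)).comp_injective (Equiv.subRight i).injective
      have e := lsum_comp_equiv (Equiv.subRight i) fun j : ℤ => E j (s + i)
      rw [hE.sum_eq_zero] at e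
      exact (lsum_mul_left _ h).trans (by
        rw [e, mul_zero])
    · refine .of_support (Set.Icc 0 (K + K') ×ˢ Set.Icc 0 K)
        ((Set.finite_Icc _ _).prod (Set.finite_Icc _ _)) fun p hp => ?_
      simp only [Set.mem_prod, Set.mem_Icc, not_and_or, not_le] at hp
      by_cases hi : p.2 < 0 ∨ K < p.2
      · rw [hK _ _ hi, zero_mul]
      · rw [hK' _ _ (by omega), mul_zero]

/-- Only the coefficient of `Λ⁰` remains, and it is the value of the operator on `1`. This is how
the modified hierarchy, with its splitting in powers of `Δ`, forces operators to vanish. -/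
theorem KillsOne.eq_zero {D : DiffOp} (hD : KillsOne D) (h : ∀ n s, 1 ≤ n → D n s = 0) :
    D = 0 := by
  obtain ⟨K, hK⟩ := hD.isPoly
  have h' : ∀ n s, n ≠ 0 → D n s = 0 := fun n s hn =>
    (lt_or_gt_of_ne hn).elim (fun hn => hK n s (.inl hn)) fun hn => h n s hn
  funext n s
  by_cases hn : n = 0
  · rw [hn, ← lsum_eq_single (f := fun n : ℤ => D n s) 0 fun j hj => h' j s hj, hD.sum_eq_zero]
    rfl
  · exact h' n s hn

theorem killsOne_deltaPos {A : DiffOp} (K : ℤ) (hA : ∀ n s, K < n → A n s = 0) :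
    KillsOne A.deltaPos where
  isPoly := by
    refine ⟨max K 0, fun n s hn => ?_⟩
    unfold deltaPos
    split_ifs with h1 h2
    · exact hA n s (by omega)
    · omega
    · rfl
  sum_eq_zero s := by
    have e : (fun n : ℤ => A.deltaPos n s) = fun n : ℤ =>
        (if 1 ≤ n then A n s else 0) -
          (if n = 0 then lsum fun j : ℕ => A (j + 1) s else 0) := by
      funext n
      unfold deltaPos
      split_ifs with h1 h2
      · omega
      all_goals simp
    rw [e, lsum_sub, lsum_int_eq_nat 1 fun q hq => if_neg (by omega),
      lsum_eq_single (f := fun n : ℤ => if n = 0 then lsum fun j : ℕ => A (j + 1) s else 0) 0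
        fun j hj => if_neg hj]
    · simp [add_comm]
    · refine .of_Icc 1 K fun n hn => ?_
      split_ifs with h
      · exact hA n s (by omega)
      · rfl
    · exact .of_Icc 0 0 fun n hn => if_neg (by omega)

end DiffOp

/-! ### Dressing operators -/

theorem lowerOp_of_pos (w : ℕ → ℝ → TimeSeries) {n : ℤ} (hn : 0 < n) (s : ℝ) :
    lowerOp w n s = 0 := if_neg (by omega)

theorem lowerOp_neg (w : ℕ → ℝ → TimeSeries) (n : ℕ) (s : ℝ) : lowerOp w (-n) s = w n s := by
  simp [lowerOp]

theorem upperOp_of_neg (w : ℕ → ℝ → TimeSeries) {n : ℤ} (hn : n < 0) (s : ℝ) :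
    upperOp w n s = 0 := if_neg (by omega)

theorem upperOp_natCast (w : ℕ → ℝ → TimeSeries) (n : ℕ) (s : ℝ) : upperOp w n s = w n s := by
  simp [upperOp]

theorem tame_lowerOp (w : ℕ → ℝ → TimeSeries) : Tame (lowerOp w) :=
  .of_bounded 0 fun _ s hn => lowerOp_of_pos w hn s

theorem lowerOp_mul_invCoeff {w : ℕ → ℝ → TimeSeries}
    (hw : ∀ s, MvPowerSeries.constantCoeff (w 0 s) ≠ 0) :
    lowerOp w ⋆ lowerOp (invCoeff (-1) w) = shift 0 := by
  funext n s
  rw [mul_apply]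
  by_cases hn : 0 < n
  · rw [shift, if_neg (by omega)]
    refine lsum_eq_zero fun i => ?_
    by_cases hi : 0 < i
    · rw [lowerOp_of_pos w hi, zero_mul]
    · rw [lowerOp_of_pos (invCoeff (-1) w) (by omega), mul_zero]
  · obtain ⟨m, rfl⟩ : ∃ m : ℕ, n = -m := ⟨(-n).toNat, by omega⟩
    have h := sum_mul_invCoeff (-1) w hw m s
    rw [shift, ← lsum_comp_equiv (Equiv.neg ℤ),
      lsum_int_eq_nat 0 fun q hq => by
        rw [Equiv.neg_apply, lowerOp_of_pos w (by omega), zero_mul],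
      lsum_eq_sum (range (m + 1)) fun i hi => by
        simp only [mem_range, not_lt] at hi
        rw [lowerOp_of_pos (invCoeff (-1) w) (by rw [Equiv.neg_apply]; omega), mul_zero]]
    refine Eq.trans (sum_congr rfl fun i hi => ?_) (h.trans ?_)
    · simp only [mem_range] at hi
      have e1 : -(0 + (i : ℤ)) = -((i : ℕ) : ℤ) := by ring
      have e2 : -(m : ℤ) - -(0 + (i : ℤ)) = -((m - i : ℕ) : ℤ) := by omega
      rw [Equiv.neg_apply, e2, e1, lowerOp_neg, lowerOp_neg]
      simp
    · simp

theorem constantCoeff_invCoeff_zero_ne {w : ℕ → ℝ → TimeSeries}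
    (hw : ∀ s, MvPowerSeries.constantCoeff (w 0 s) ≠ 0) (σ : ℤ) (s : ℝ) :
    MvPowerSeries.constantCoeff (invCoeff σ w 0 s) ≠ 0 := by
  rw [invCoeff, MvPowerSeries.constantCoeff_inv]
  exact inv_ne_zero (hw s)

/-- The recursion for `invCoeff` gives a right inverse. That right inverse has a right inverse of
its own, which by associativity must be the original operator. -/
theorem invCoeff_mul_lowerOp {w : ℕ → ℝ → TimeSeries}
    (hw : ∀ s, MvPowerSeries.constantCoeff (w 0 s) ≠ 0) :
    lowerOp (invCoeff (-1) w) ⋆ lowerOp w = shift 0 := by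
  have h1 := lowerOp_mul_invCoeff hw
  have h2 := lowerOp_mul_invCoeff (constantCoeff_invCoeff_zero_ne hw (-1))
  have t := fun w => tame_lowerOp w
  have h3 : lowerOp w = lowerOp (invCoeff (-1) (invCoeff (-1) w)) := by
    rw [← mul_shift_zero (lowerOp w), ← h2, ← (t _).mul_assoc (t _) (t _), h1, shift_zero_mul]
  calc lowerOp (invCoeff (-1) w) ⋆ lowerOp w
      = lowerOp (invCoeff (-1) w) ⋆ lowerOp (invCoeff (-1) (invCoeff (-1) w)) := by rw [← h3]
    _ = shift 0 := h2

theorem L₁pow_of_lt (w : ℕ → ℝ → TimeSeries) {q n : ℤ} (h : q < n) (s : ℝ) :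
    L₁pow w q n s = 0 := by
  refine lsum_eq_zero fun i => ?_
  by_cases hi : q < i
  · rw [mul_shift, lowerOp_of_pos w (by omega), zero_mul]
  · rw [lowerOp_of_pos (invCoeff (-1) w) (by omega), mul_zero]

theorem tame_L₁pow (w : ℕ → ℝ → TimeSeries) (q : ℤ) : Tame (L₁pow w q) :=
  .of_bounded q fun _ s hn => L₁pow_of_lt w hn s

theorem killsOne_deltaPos_L₁pow (w : ℕ → ℝ → TimeSeries) (q : ℤ) :
    KillsOne (L₁pow w q).deltaPos :=
  killsOne_deltaPos q fun _ s hn => L₁pow_of_lt w hn s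

theorem deltaPos_L₁pow_eq_zero (w : ℕ → ℝ → TimeSeries) {q n : ℤ} (h : n < 0 ∨ q < n ∨ q ≤ 0)
    (s : ℝ) : (L₁pow w q).deltaPos n s = 0 := by
  unfold deltaPos
  split_ifs with h1 h2
  · exact L₁pow_of_lt w (by omega) s
  · rw [lsum_eq_zero fun j => L₁pow_of_lt w (by omega) s, neg_zero]
  · rfl

theorem L₁pow_mul_lowerOp {w : ℕ → ℝ → TimeSeries}
    (hw : ∀ s, MvPowerSeries.constantCoeff (w 0 s) ≠ 0) (q n : ℤ) (s : ℝ) :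
    (L₁pow w q ⋆ lowerOp w) n s = lowerOp w (n - q) s := by
  have t := fun w => tame_lowerOp w
  rw [L₁pow, ((t _).mul (tame_shift q)).mul_assoc (t _) (t _), invCoeff_mul_lowerOp hw,
    mul_shift_zero, mul_shift]

/-- To a given order `c` restricts to `q ≤ K`, and the triangular shape of `g` restricts to `m ≤ i ≤
q`; so both indices stay in `[m, K]`. -/
theorem locFin_tame_mul {c : DiffOp} (hc : Tame c) (s : ℝ) (m : ℤ) {g : ℤ → ℤ → TimeSeries}
    (hg : ∀ i q, i < m ∨ q < i → g i q = 0) :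
    LocFin fun p : ℤ × ℤ => c p.2 s * g p.1 p.2 := fun γ => by
  obtain ⟨K, hK⟩ := hc γ
  refine ((Set.finite_Icc m K).prod (Set.finite_Icc m K)).subset fun p hp => ?_
  by_contra hn
  refine hp ?_
  by_cases h1 : K < p.2
  · exact (hK _ h1 s).mul_right _ γ le_rfl
  · have h := hg p.1 p.2 (by simp only [Set.mem_prod, Set.mem_Icc] at hn; omega)
    simp only [h, mul_zero, map_zero]

/-! ### Expansions in powers of `L` and their projections -/

section Expansion

variable {w : ℕ → ℝ → TimeSeries} {c A : DiffOp}

/-- If `A W = ∑ c_q W Λ^q` then `A = ∑ c_q L^q`. -/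
theorem expansion_of_dressed (hc : Tame c) {X : DiffOp}
    (hX : ∀ n s, X n s = lsum fun q : ℤ => c q s * lowerOp w (n - q) s)
    (n : ℤ) (s : ℝ) :
    (X ⋆ lowerOp (invCoeff (-1) w)) n s = lsum fun q : ℤ => c q s * L₁pow w q n s := by
  have hg : ∀ i q, i < n ∨ q < i →
      lowerOp w (i - q) s * lowerOp (invCoeff (-1) w) (n - i) (s + i) = 0 := by
    intro i q hiq
    obtain h | h := hiq
    · rw [lowerOp_of_pos (invCoeff (-1) w) (by omega), mul_zero]
    · rw [lowerOp_of_pos w (by omega), zero_mul]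
  have h2 := locFin_tame_mul hc s n hg
  have h3 : ∀ i, LocFin fun q => c q s * lowerOp w (i - q) s := fun i => by
    -- The indicator of `i' = i` puts a single row into the triangular shape required by
    -- `locFin_tame_mul`.
    have h := (locFin_tame_mul hc s i (g := fun i' q => if i' = i then lowerOp w (i' - q) s else 0)
      fun i' q h => by
        split_ifs with h1
        · exact lowerOp_of_pos w (by omega) s
        · rfl).of_prod_right (f := fun i' q =>
          c q s * if i' = i then lowerOp w (i' - q) s else 0) i
    simpa using h
  rw [mul_apply]
  simp only [hX]
  calc _ = lsum fun i : ℤ => lsum fun q : ℤ =>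
          c q s * (lowerOp w (i - q) s * lowerOp (invCoeff (-1) w) (n - i) (s + i)) := by
        congr 1
        funext i
        rw [← lsum_mul_right _ (h3 i)]
        simp only [mul_assoc]
    _ = lsum fun q : ℤ => lsum fun i : ℤ =>
          c q s * (lowerOp w (i - q) s * lowerOp (invCoeff (-1) w) (n - i) (s + i)) :=
        lsum_comm h2
    _ = _ := by
        congr 1
        funext q
        rw [lsum_mul_left]
        · simp only [L₁pow, mul_apply (lowerOp w ⋆ shift q), mul_shift]
        · exact .of_Icc n q fun i hi => hg i q hi

variable (hc : Tame c) (hA : ∀ n s, A n s = lsum fun q : ℤ => c q s * L₁pow w q n s)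

include hc hA

/-- The functions `c_q` stand on the left of the powers of `Λ`, so they pass through the projection.
For exponent zero this is an interchange of two locally finite sums. -/
theorem deltaPos_expansion (n : ℤ) (s : ℝ) :
    A.deltaPos n s = lsum fun q : ℤ => c q s * (L₁pow w q).deltaPos n s := by
  unfold deltaPos
  split_ifs with h1 h2
  · exact hA n s
  · simp only [hA]
    have h := locFin_tame_mul hc s 1 (g := fun i q => if 1 ≤ i then L₁pow w q i s else 0) (by
      intro i q h
      split_ifs with h1
      · exact L₁pow_of_lt w (by omega) s
      · rfl)
    have h' := h.comp_injective (e := fun p : ℕ × ℤ => ((p.1 : ℤ) + 1, p.2)) (by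
      intro p q hpq
      simp only [Prod.mk.injEq] at hpq
      exact Prod.ext (by omega) hpq.2)
    have h'' : LocFin fun p : ℕ × ℤ => c p.2 s * L₁pow w p.2 (p.1 + 1) s := by
      convert h' using 2 with p
      rw [if_pos (by omega)]
    rw [lsum_comm h'', ← lsum_neg]
    congr 1
    funext q
    rw [lsum_mul_left, mul_neg]
    refine .of_support (Set.Iic q.toNat) (Set.finite_Iic _) fun j hj => ?_
    simp only [Set.mem_Iic] at hj
    exact L₁pow_of_lt w (by omega) s
  · simp

theorem deltaPos_mul_expansion (Y : DiffOp) (n : ℤ) (s : ℝ) :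
    (A.deltaPos ⋆ Y) n s = lsum fun q : ℤ => c q s * ((L₁pow w q).deltaPos ⋆ Y) n s := by
  have hg : ∀ i q, i < 0 ∨ q < i →
      (L₁pow w q).deltaPos i s * Y (n - i) (s + i) = 0 := by
    intro i q hiq
    rw [deltaPos_L₁pow_eq_zero w (by omega), zero_mul]
  have h2 := locFin_tame_mul hc s 0 hg
  have h3 : ∀ i, LocFin fun q => c q s * (L₁pow w q).deltaPos i s := fun i =>
    (locFin_tame_mul hc s 0 (g := fun i q => (L₁pow w q).deltaPos i s)
      (fun i q h => deltaPos_L₁pow_eq_zero w (by omega) s)).of_prod_right (f := fun i q =>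
          c q s * (L₁pow w q).deltaPos i s) i
  rw [mul_apply]
  simp only [deltaPos_expansion hc hA]
  calc _ = lsum fun i : ℤ => lsum fun q : ℤ =>
          c q s * ((L₁pow w q).deltaPos i s * Y (n - i) (s + i)) := by
        congr 1
        funext i
        rw [← lsum_mul_right _ (h3 i)]
        simp only [mul_assoc]
    _ = lsum fun q : ℤ => lsum fun i : ℤ =>
          c q s * ((L₁pow w q).deltaPos i s * Y (n - i) (s + i)) :=
        lsum_comm h2
    _ = _ := by
        congr 1
        funext q
        exact lsum_mul_left _ ((killsOne_deltaPos_L₁pow w q).isPoly.composable Y n s)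

end Expansion

/-! ### Exponentials of power series over a ring -/

section ExpCoeff

variable {A : Type} [Ring A]

theorem coeff_pow_eq_zero_of_lt {a : PowerSeries A} (h0 : PowerSeries.coeff 0 a = 0) :
    ∀ {n j : ℕ}, n < j → PowerSeries.coeff n (a ^ j) = 0 := by
  intro n j
  induction j generalizing n with
  | zero => simp
  | succ j ih =>
    intro hn
    rw [pow_succ, PowerSeries.coeff_mul]
    refine sum_eq_zero fun p hp => ?_
    have hp' := mem_antidiagonal.1 hp
    by_cases h : p.1 < j
    · rw [ih h, zero_mul]
    · rw [show p.2 = 0 by omega, h0, mul_zero]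

/-- The power rule for the Euler operator `u d/du`, for commuting coefficients. -/
theorem coeff_pow_succ_euler {a : PowerSeries A}
    (hc : ∀ i j, Commute (PowerSeries.coeff i a) (PowerSeries.coeff j a)) (j n : ℕ) :
    n • PowerSeries.coeff n (a ^ (j + 1)) = (j + 1) •
      PowerSeries.coeff n (PowerSeries.mk (fun i => i • PowerSeries.coeff i a) * a ^ j) := by
  have hcomm : a * PowerSeries.mk (fun i => i • PowerSeries.coeff i a) =
      PowerSeries.mk (fun i => i • PowerSeries.coeff i a) * a := by
    ext n
    rw [PowerSeries.coeff_mul, PowerSeries.coeff_mul, ← Nat.sum_antidiagonal_swap]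
    refine sum_congr rfl fun p _ => ?_
    simp only [Prod.fst_swap, Prod.snd_swap, PowerSeries.coeff_mk]
    exact ((hc _ _).smul_right _).eq
  induction j generalizing n with
  | zero => simp
  | succ j ih =>
    have hl : n • PowerSeries.coeff n (a ^ (j + 1) * a) =
        PowerSeries.coeff n (PowerSeries.mk (fun i => i • PowerSeries.coeff i (a ^ (j + 1))) * a) +
        PowerSeries.coeff n (a ^ (j + 1) * PowerSeries.mk (fun i => i • PowerSeries.coeff i a)) := by
      simp only [PowerSeries.coeff_mul, smul_sum, ← sum_add_distrib]
      refine sum_congr rfl fun p hp => ?_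
      rw [← mem_antidiagonal.1 hp, PowerSeries.coeff_mk, PowerSeries.coeff_mk, add_smul,
        smul_mul_assoc, mul_smul_comm]
    have he : PowerSeries.mk (fun i => i • PowerSeries.coeff i (a ^ (j + 1))) =
        (j + 1) • (PowerSeries.mk (fun i => i • PowerSeries.coeff i a) * a ^ j) := by
      ext i
      rw [PowerSeries.coeff_mk, ih, map_nsmul]
    have hp : a ^ (j + 1) * PowerSeries.mk (fun i => i • PowerSeries.coeff i a) =
        PowerSeries.mk (fun i => i • PowerSeries.coeff i a) * a ^ (j + 1) :=
      (Commute.pow_left hcomm (j + 1)).eq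
    rw [pow_succ, hl, he, hp, smul_mul_assoc, map_nsmul, mul_assoc, ← pow_succ, add_smul (j + 1) 1,
      one_smul]

variable [Algebra ℂ A] {a : PowerSeries A} (h0 : PowerSeries.coeff 0 a = 0)

theorem expCoeff_zero (a : PowerSeries A) : expCoeff a 0 = 1 := by simp [expCoeff]

theorem expCoeff_one (a : PowerSeries A) : expCoeff a 1 = PowerSeries.coeff 1 a := by
  simp [expCoeff, sum_range_succ, PowerSeries.coeff_one]

include h0 in
theorem expCoeff_two : expCoeff a 2 = PowerSeries.coeff 2 a +
    (1 / 2 : ℂ) • (PowerSeries.coeff 1 a * PowerSeries.coeff 1 a) := by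
  simp [expCoeff, sum_range_succ, PowerSeries.coeff_one, pow_two, PowerSeries.coeff_mul,
    Nat.antidiagonal_succ, h0]

include h0 in
theorem expCoeff_eq_of_le {n K : ℕ} (hn : n ≤ K) :
    expCoeff a n = ∑ j ∈ range (K + 1), (1 / (j.factorial : ℂ)) • PowerSeries.coeff n (a ^ j) := by
  refine sum_subset (range_subset_range.2 (by omega)) fun j _ hj => ?_
  rw [coeff_pow_eq_zero_of_lt h0 (by simp at hj; omega), smul_zero]

include h0 in
-- Coefficients of `u d/du (exp a) = (u d/du a) exp a`, which is valid in the noncommutative ring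
-- because the coefficients of `a` commute.
theorem natCast_smul_expCoeff
    (hc : ∀ i j, Commute (PowerSeries.coeff i a) (PowerSeries.coeff j a)) (n : ℕ) :
    (n : ℂ) • expCoeff a n = ∑ p ∈ antidiagonal n,
      ((p.1 : ℂ) • PowerSeries.coeff p.1 a) * expCoeff a p.2 := by
  have hr : ∀ p ∈ antidiagonal n, ((p.1 : ℂ) • PowerSeries.coeff p.1 a) * expCoeff a p.2 =
      ∑ j ∈ range (n + 1), (1 / (j.factorial : ℂ)) •
        (((p.1 : ℂ) • PowerSeries.coeff p.1 a) * PowerSeries.coeff p.2 (a ^ j)) := by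
    intro p hp
    rw [expCoeff_eq_of_le h0 (K := n) (by have := mem_antidiagonal.1 hp; omega), mul_sum]
    simp only [mul_smul_comm]
  rw [sum_congr rfl hr, sum_comm, expCoeff_eq_of_le h0 (Nat.le_succ n), smul_sum,
    sum_range_succ']
  -- The term `j = 0` is killed by the factor `n` if `n = 0`, and by the vanishing of the higher
  -- coefficients of `1` otherwise.
  have hz : (n : ℂ) • (1 / ((0 : ℕ).factorial : ℂ)) • PowerSeries.coeff n (a ^ 0) = 0 := by
    rcases n with _ | n <;> simp [PowerSeries.coeff_one]
  rw [hz, add_zero]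
  refine sum_congr rfl fun j _ => ?_
  have h := coeff_pow_succ_euler hc j n
  rw [← smul_sum, smul_comm, Nat.cast_smul_eq_nsmul, h, PowerSeries.coeff_mul,
    ← Nat.cast_smul_eq_nsmul ℂ, smul_smul]
  congr 1
  · rw [Nat.factorial_succ]
    have : (j.factorial : ℂ) ≠ 0 := Nat.cast_ne_zero.2 j.factorial_ne_zero
    have : (j : ℂ) + 1 ≠ 0 := by exact_mod_cast j.succ_ne_zero
    push_cast
    field_simp
  · simp only [PowerSeries.coeff_mk, Nat.cast_smul_eq_nsmul]

end ExpCoeff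

/-! ### The operators `G` -/

/-- The derivation `∂ / ∂x^{(a+1)}_q`, and `0` for `q ≤ 0`. -/
def dZ (a : Fin 2) (q : ℤ) : Module.End ℂ TimeSeries := timeDeriv a q.toNat

/-- The operator `G a n`, and `0` for `n < 0`. -/
def GZ (a : Fin 2) (n : ℤ) : Module.End ℂ TimeSeries := if 0 ≤ n then G a n.toNat else 0

/-- The function `q x^{(a+1)}_q`, and `0` for `q ≤ 0`. -/
def mu (x₀ : Fin 2 × ℕ+ →₀ ℂ) (a : Fin 2) (q : ℤ) : TimeSeries :=
  (q.toNat : ℂ) • time x₀ a q.toNat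

theorem dZ_of_nonpos (a : Fin 2) {q : ℤ} (hq : q ≤ 0) : dZ a q = 0 := by
  rw [dZ, Int.toNat_of_nonpos hq, timeDeriv_zero]

theorem dZ_natCast (a : Fin 2) (q : ℕ) : dZ a q = timeDeriv a q := rfl

theorem dZ_mul (a : Fin 2) (q : ℤ) (f g : TimeSeries) :
    dZ a q (f * g) = dZ a q f * g + f * dZ a q g := timeDeriv_mul _ _ _ _

theorem dZ_comm (a b : Fin 2) (p q : ℤ) (f : TimeSeries) :
    dZ a p (dZ b q f) = dZ b q (dZ a p f) := timeDeriv_comm _ _ _ _ _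

theorem mu_of_nonpos (x₀ : Fin 2 × ℕ+ →₀ ℂ) (a : Fin 2) {q : ℤ} (hq : q ≤ 0) :
    mu x₀ a q = 0 := by
  rw [mu, Int.toNat_of_nonpos hq, time_zero, smul_zero]

theorem GZ_of_neg (a : Fin 2) {n : ℤ} (hn : n < 0) : GZ a n = 0 := if_neg (by omega)

theorem GZ_natCast (a : Fin 2) (n : ℕ) : GZ a n = G a n := by simp [GZ]

theorem dZ_mu (x₀ : Fin 2 × ℕ+ →₀ ℂ) (a b : Fin 2) (p q : ℤ) :
    dZ a p (mu x₀ b q) = if a = b ∧ p = q ∧ 0 < q then (q : ℂ) • 1 else 0 := by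
  rw [dZ, mu, map_smul, timeDeriv_time]
  by_cases h : 0 < q
  · have e1 : ((q.toNat : ℕ) : ℂ) = (q : ℂ) := by
      rw [← Int.cast_natCast, Int.toNat_of_nonneg h.le]
    have e2 : (a = b ∧ p.toNat = q.toNat ∧ 0 < q.toNat) ↔ (a = b ∧ p = q ∧ 0 < q) := by
      constructor <;> rintro ⟨h1, h2, h3⟩ <;> exact ⟨h1, by omega, by omega⟩
    rw [e1]
    simp only [e2]
    split_ifs <;> simp
  · rw [if_neg (by omega), if_neg (by omega), smul_zero]

/-- A sum over the antidiagonal of `n` whose term at `0 + n` vanishes. -/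
theorem sum_antidiagonal_eq_Ioc {E : Type} [AddCommMonoid E] (n : ℕ) {J : ℤ} (hJ : n ≤ J)
    (f : ℤ → ℤ → E) (h0 : f 0 n = 0) (hneg : ∀ i j : ℤ, j < 0 → f i j = 0) :
    ∑ p ∈ antidiagonal n, f p.1 p.2 = ∑ j ∈ Ioc 0 J, f j (n - j) := by
  rw [← sum_subset (Ioc_subset_Ioc_right hJ) fun j _ hj => by
      simp only [mem_Ioc, not_and_or, not_le, not_lt] at *
      exact hneg _ _ (by omega),
    Nat.sum_antidiagonal_eq_sum_range_succ (f := fun i j : ℕ => f i j), sum_range_succ']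
  simp only [Nat.cast_zero, Nat.sub_zero, h0, add_zero]
  refine sum_bij' (fun i _ => (i : ℤ) + 1) (fun j _ => (j - 1).toNat) ?_ ?_ ?_ ?_ ?_
  · intro i hi; simp only [mem_range, mem_Ioc] at *; omega
  · intro i hi; simp only [mem_range, mem_Ioc] at *; omega
  · intro i hi; simp
  · intro i hi; simp only [mem_Ioc] at *; omega
  · intro i hi
    simp only [mem_range] at hi
    congr 1
    omega

theorem natCast_smul_G (a : Fin 2) (n : ℕ) (f : TimeSeries) :
    (n : ℂ) • G a n f = -∑ p ∈ antidiagonal n, timeDeriv a p.1 (G a p.2 f) := by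
  have h := natCast_smul_expCoeff
    (a := PowerSeries.mk fun i => (-(1 / (i : ℂ))) • timeDeriv a i) (by simp [timeDeriv_zero])
    (fun i j => by
      simp only [PowerSeries.coeff_mk]
      refine Commute.smul_left (Commute.smul_right ?_ _) _
      exact LinearMap.ext fun f => timeDeriv_comm a a i j f) n
  have h' := congrArg (fun T : Module.End ℂ TimeSeries => T f) h
  simp only [LinearMap.smul_apply, LinearMap.sum_apply, Module.End.mul_apply,
    PowerSeries.coeff_mk] at h'
  rw [G, h', ← sum_neg_distrib]
  refine sum_congr rfl fun p _ => ?_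
  rcases Nat.eq_zero_or_pos p.1 with h | h
  · simp [h, timeDeriv_zero]
  · have : (p.1 : ℂ) ≠ 0 := Nat.cast_ne_zero.2 h.ne'
    rw [smul_smul, mul_neg, mul_one_div_cancel this, neg_smul, one_smul, G]

theorem GZ_zero (a : Fin 2) : GZ a 0 = 1 := by
  rw [show (0 : ℤ) = ((0 : ℕ) : ℤ) from rfl, GZ_natCast, G, expCoeff_zero]

/-- The logarithmic derivative of `G` in its variable. The upper bound `J` is free because `GZ`
vanishes at negative indices; later sums use this freedom to share a common range. -/
theorem intCast_smul_GZ (a : Fin 2) (n J : ℤ) (hJ : n ≤ J) (f : TimeSeries) :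
    (n : ℂ) • GZ a n f = -∑ j ∈ Ioc 0 J, dZ a j (GZ a (n - j) f) := by
  by_cases hn : n < 0
  · rw [GZ_of_neg a hn, sum_eq_zero]
    · simp
    · intro j hj
      rw [GZ_of_neg a (by simp only [mem_Ioc] at hj; omega)]
      simp
  · lift n to ℕ using by omega
    rw [← sum_antidiagonal_eq_Ioc n hJ fun i j => dZ a i (GZ a j f)]
    · simpa [GZ_natCast, dZ_natCast] using natCast_smul_G a n f
    · rw [dZ_of_nonpos a le_rfl]; rfl
    · intro i j hj
      rw [GZ_of_neg a hj]; simp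

theorem int_strong_induction {P : ℤ → Prop} (hneg : ∀ n < 0, P n)
    (hstep : ∀ n, 0 ≤ n → (∀ m < n, P m) → P n) (n : ℤ) : P n := by
  by_cases hn : n < 0
  · exact hneg n hn
  · lift n to ℕ using by omega
    induction n using Nat.strong_induction_on with
    | _ n ih =>
      refine hstep n (by omega) fun m hm => ?_
      by_cases h : m < 0
      · exact hneg m h
      · lift m to ℕ using by omega
        exact ih m (by omega) h

theorem GZ_mem_lsumMaps (a : Fin 2) (n : ℤ) : GZ a n ∈ lsumMaps := by
  refine int_strong_induction (P := fun n => GZ a n ∈ lsumMaps) (fun n hn => ?_)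
    (fun n hn ih => ?_) n
  · rw [GZ_of_neg a hn]; exact zero_mem _
  · obtain rfl | h := hn.eq_or_lt
    · rw [GZ_zero]; exact one_mem _
    · have e : GZ a n = (-(1 / (n : ℂ))) • ∑ j ∈ Ioc 0 n, dZ a j * GZ a (n - j) := by
        refine LinearMap.ext fun f => ?_
        have h1 := intCast_smul_GZ a n n le_rfl f
        have h2 : (n : ℂ) ≠ 0 := by exact_mod_cast h.ne'
        rw [LinearMap.smul_apply, LinearMap.sum_apply, neg_smul, ← smul_neg]
        simp only [Module.End.mul_apply]
        rw [← h1, smul_smul, one_div_mul_cancel h2, one_smul]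
      rw [e]
      refine lsumMaps.smul_mem (lsumMaps.sum_mem fun j hj => ?_) _
      exact lsumMaps.mul_mem (timeDeriv_mem_lsumMaps _ _)
        (ih _ (by simp only [mem_Ioc] at hj; omega))

theorem intCast_smul_right_injective {n : ℤ} (hn : n ≠ 0) {f g : TimeSeries}
    (h : (n : ℂ) • f = (n : ℂ) • g) : f = g :=
  smul_right_injective _ (Int.cast_ne_zero.2 hn : (n : ℂ) ≠ 0) h

theorem GZ_dZ (a b : Fin 2) (n q : ℤ) (f : TimeSeries) :
    GZ a n (dZ b q f) = dZ b q (GZ a n f) := by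
  refine int_strong_induction (P := fun n => GZ a n (dZ b q f) = dZ b q (GZ a n f))
    (fun n hn => by simp [GZ_of_neg a hn]) (fun n hn ih => ?_) n
  obtain rfl | h := hn.eq_or_lt
  · simp [GZ_zero]
  · refine intCast_smul_right_injective h.ne' ?_
    rw [← map_smul (dZ b q), intCast_smul_GZ a n n le_rfl, intCast_smul_GZ a n n le_rfl, map_neg,
      map_sum]
    congr 1
    refine sum_congr rfl fun j hj => ?_
    rw [ih _ (by simp only [mem_Ioc] at hj; omega), dZ_comm]

/-- The operator `G₁(z)` is the translation `x_r ↦ x_r - z⁻ʳ/r`, hence sends `r x_r` to `r x_r -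
z⁻ʳ`. In coefficients this follows by induction from the recursion for `G`, where the derivative of
`r x_r` contributes at `j = r` only. -/
theorem GZ_mu_mul (x₀ : Fin 2 × ℕ+ →₀ ℂ) (a : Fin 2) (n r : ℤ) (hr : 0 < r) (f : TimeSeries) :
    GZ a n (mu x₀ a r * f) = mu x₀ a r * GZ a n f - GZ a (n - r) f := by
  refine int_strong_induction
    (P := fun n => GZ a n (mu x₀ a r * f) = mu x₀ a r * GZ a n f - GZ a (n - r) f)
    (fun n hn => by simp [GZ_of_neg a hn, GZ_of_neg a (show n - r < 0 by omega)])
    (fun n hn ih => ?_) n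
  obtain rfl | h := hn.eq_or_lt
  · simp [GZ_zero, GZ_of_neg a (show -r < 0 by omega)]
  · refine intCast_smul_right_injective h.ne' ?_
    have h1 : ∀ j ∈ Ioc 0 n, dZ a j (GZ a (n - j) (mu x₀ a r * f)) =
        mu x₀ a r * dZ a j (GZ a (n - j) f) - dZ a j (GZ a (n - r - j) f) +
          (if j = r then (r : ℂ) • GZ a (n - r) f else 0) := fun j hj => by
      rw [ih _ (by simp only [mem_Ioc] at hj; omega), map_sub, dZ_mul, dZ_mu,
        show n - j - r = n - r - j by ring]
      by_cases hjr : j = r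
      · subst hjr
        rw [if_pos ⟨rfl, rfl, hr⟩, if_pos rfl, smul_mul_assoc, one_mul]
        ring
      · rw [if_neg (fun h => hjr h.2.1), if_neg hjr]
        ring
    have h2 : (∑ j ∈ Ioc 0 n, if j = r then (r : ℂ) • GZ a (n - r) f else 0) =
        (r : ℂ) • GZ a (n - r) f := by
      rw [sum_ite_eq']
      split_ifs with h
      · rfl
      · simp only [mem_Ioc, not_and_or, not_lt, not_le] at h
        rw [GZ_of_neg a (by omega)]
        simp
    have h3 := intCast_smul_GZ a n n le_rfl f
    have h4 := intCast_smul_GZ a (n - r) n (by omega) f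
    rw [intCast_smul_GZ a n n le_rfl, sum_congr rfl h1, sum_add_distrib, h2, sum_sub_distrib,
      ← mul_sum, smul_sub, ← mul_smul_comm, h3]
    rw [← neg_eq_iff_eq_neg] at h4
    rw [← h4]
    push_cast
    rw [sub_smul]
    ring

theorem GZ_mu_mul_of_ne (x₀ : Fin 2 × ℕ+ →₀ ℂ) {a b : Fin 2} (hab : b ≠ a) (n r : ℤ)
    (f : TimeSeries) : GZ b n (mu x₀ a r * f) = mu x₀ a r * GZ b n f := by
  refine int_strong_induction
    (P := fun n => GZ b n (mu x₀ a r * f) = mu x₀ a r * GZ b n f)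
    (fun n hn => by simp [GZ_of_neg b hn]) (fun n hn ih => ?_) n
  obtain rfl | h := hn.eq_or_lt
  · simp [GZ_zero]
  · refine intCast_smul_right_injective h.ne' ?_
    rw [intCast_smul_GZ b n n le_rfl, ← mul_smul_comm, intCast_smul_GZ b n n le_rfl, mul_neg,
      mul_sum]
    congr 1
    refine sum_congr rfl fun j hj => ?_
    rw [ih _ (by simp only [mem_Ioc] at hj; omega), dZ_mul, dZ_mu, if_neg (fun h => hab h.1),
      zero_mul, zero_add]

/-! ### The quadratic modes of the vertex operators -/

theorem sum_Ioo_reflect {E : Type} [AddCommMonoid E] (k : ℤ) (f : ℤ → E) :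
    ∑ j ∈ Ioo 0 k, f (k - j) = ∑ j ∈ Ioo 0 k, f j := by
  refine sum_bij' (fun j _ => k - j) (fun j _ => k - j) ?_ ?_ ?_ ?_ ?_ <;> intro j hj <;>
    simp only [mem_Ioo] at * <;> omega

theorem sum_antidiagonal_eq_Ioo {E : Type} [AddCommMonoid E] (n : ℕ) (f : ℤ → ℤ → E)
    (h0 : f 0 n = 0) (h1 : f n 0 = 0) :
    ∑ p ∈ antidiagonal n, f p.1 p.2 = ∑ j ∈ Ioo 0 (n : ℤ), f j (n - j) := by
  rcases n with _ | m
  · simpa using h0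
  rw [Nat.sum_antidiagonal_eq_sum_range_succ (f := fun i j : ℕ => f i j), sum_range_succ,
    sum_range_succ']
  simp only [Nat.cast_zero, Nat.sub_zero, h0, Nat.sub_self, h1, add_zero]
  refine sum_bij' (fun i _ => (i : ℤ) + 1) (fun j _ => (j - 1).toNat) ?_ ?_ ?_ ?_ ?_
  · intro i hi; simp only [mem_range, mem_Ioo] at *; omega
  · intro i hi; simp only [mem_range, mem_Ioo] at *; omega
  · intro i hi; simp
  · intro i hi; simp only [mem_Ioo] at *; omega
  · intro i hi
    simp only [mem_range] at hi
    congr 1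
    omega

/-- Half of the sum of the `p_i p_j` with `i + j = r`, and the correction from normal ordering. -/
def quadMu (x₀ : Fin 2 × ℕ+ →₀ ℂ) (a : Fin 2) (r : ℤ) : TimeSeries :=
  (((r : ℂ) - 1) / 2) • mu x₀ a r +
    (1 / 2 : ℂ) • ∑ j ∈ Ioo 0 r, mu x₀ a j * mu x₀ a (r - j)

/-- The part of the quadratic mode that is a second order operator with constant coefficients. -/
def quadDeriv (a : Fin 2) (r : ℤ) (f : TimeSeries) : TimeSeries :=
  (1 / 2 : ℂ) • ∑ j ∈ Ioo 0 r, dZ a j (dZ a (r - j) f) - (((r : ℂ) + 1) / 2) • dZ a r f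

theorem mu_natCast (x₀ : Fin 2 × ℕ+ →₀ ℂ) (a : Fin 2) (r : ℕ) :
    mu x₀ a r = (r : ℂ) • time x₀ a r := rfl

theorem vertexMul_zero (x₀ : Fin 2 × ℕ+ →₀ ℂ) (a : Fin 2) (r : ℕ) :
    vertexMul x₀ a 0 r = if r = 0 then 1 else 0 := by
  rw [vertexMul, expCoeff_zero, PowerSeries.coeff_one]

theorem vertexMul_one (x₀ : Fin 2 × ℕ+ →₀ ℂ) (a : Fin 2) (r : ℕ) :
    vertexMul x₀ a 1 r = mu x₀ a r := by
  simp [vertexMul, expCoeff_one, mu]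

/-- The linear term comes from `(k choose 2) x_k = ((k - 1)/2) k x_k`, the quadratic one from half
the square of the part of order one in `u`. -/
theorem vertexMul_two (x₀ : Fin 2 × ℕ+ →₀ ℂ) (a : Fin 2) (r : ℕ) :
    vertexMul x₀ a 2 r = quadMu x₀ a r := by
  have e : PowerSeries.coeff r (PowerSeries.mk (fun k => mu x₀ a k) *
      PowerSeries.mk (fun k => mu x₀ a k)) = ∑ j ∈ Ioo 0 (r : ℤ), mu x₀ a j * mu x₀ a (r - j) := by
    rw [PowerSeries.coeff_mul]
    simp only [PowerSeries.coeff_mk]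
    exact sum_antidiagonal_eq_Ioo r (fun i j => mu x₀ a i * mu x₀ a j)
      (by simp [mu_of_nonpos]) (by simp [mu_of_nonpos])
  have e1 : PowerSeries.mk (fun k : ℕ => ((k.choose 1 : ℕ) : ℂ) • time x₀ a k) =
      PowerSeries.mk fun k : ℕ => mu x₀ a k := by
    ext1 k
    simp [mu_natCast]
  rw [vertexMul, expCoeff_two (by simp; rfl), quadMu, ← e]
  simp only [PowerSeries.coeff_mk, if_neg one_ne_zero, if_neg two_ne_zero, e1, map_add]
  congr 1
  · rw [mu_natCast, smul_smul, Nat.cast_choose_two]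
    congr 1
    push_cast
    ring

theorem vertexDeriv_zero (a : Fin 2) (r : ℕ) :
    vertexDeriv a 0 r = if r = 0 then 1 else 0 := by
  rw [vertexDeriv, expCoeff_zero, PowerSeries.coeff_one]

theorem vertexDeriv_one (a : Fin 2) (r : ℕ) : vertexDeriv a 1 r = timeDeriv a r := by
  rw [vertexDeriv, expCoeff_one]
  simp only [PowerSeries.coeff_mk, if_neg one_ne_zero, Ring.choose_one_right]
  rcases r.eq_zero_or_pos with rfl | hr
  · simp [timeDeriv_zero]
  · have : (r : ℂ) ≠ 0 := Nat.cast_ne_zero.2 hr.ne'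
    push_cast
    rw [neg_neg, div_self this, one_smul]

theorem ring_choose_two {R : Type} [CommRing R] [BinomialRing R] (e : R) :
    2 * Ring.choose e 2 = e * (e - 1) := by
  have h := Ring.descPochhammer_eq_factorial_smul_choose e 2
  rw [← Polynomial.aeval_eq_smeval, nsmul_eq_mul] at h
  simpa [descPochhammer, mul_comm] using h.symm

/-- The binomial coefficient of `-k` over `2` is `k(k + 1)/2`; divided by `-k` it gives the factor
`-(k + 1)/2` of the first order term. -/
theorem vertexDeriv_two (a : Fin 2) (r : ℕ) (f : TimeSeries) :
    vertexDeriv a 2 r f = quadDeriv a r f := by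
  have e : PowerSeries.coeff r (PowerSeries.mk (fun k => timeDeriv a k) *
      PowerSeries.mk (fun k => timeDeriv a k)) f =
        ∑ j ∈ Ioo 0 (r : ℤ), dZ a j (dZ a (r - j) f) := by
    rw [PowerSeries.coeff_mul]
    simp only [PowerSeries.coeff_mk, LinearMap.sum_apply, Module.End.mul_apply]
    exact sum_antidiagonal_eq_Ioo r (fun i j => dZ a i (dZ a j f))
      (by simp [dZ_of_nonpos]) (by simp [dZ_of_nonpos])
  have e1 : PowerSeries.mk (fun k : ℕ =>
      (-(Ring.choose (-(k : ℤ)) 1 : ℂ) / (k : ℂ)) • timeDeriv a k) =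
      PowerSeries.mk fun k : ℕ => timeDeriv a k := by
    ext1 k
    have := vertexDeriv_one a k
    rw [vertexDeriv, expCoeff_one] at this
    simpa using this
  have h2 : (2 : ℂ) * (Ring.choose (-(r : ℤ)) 2 : ℂ) = r * (r + 1) := by
    rw [ring_choose_two]
    push_cast
    ring
  rw [vertexDeriv, expCoeff_two (by simp; rfl), quadDeriv, ← e]
  simp only [PowerSeries.coeff_mk, if_neg one_ne_zero, if_neg two_ne_zero, e1, map_add]
  rw [LinearMap.add_apply, add_comm, sub_eq_add_neg]
  congr 1
  rw [LinearMap.smul_apply, dZ_natCast, ← neg_smul]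
  rcases r.eq_zero_or_pos with rfl | hr
  · simp [timeDeriv_zero]
  · have : (r : ℂ) ≠ 0 := Nat.cast_ne_zero.2 hr.ne'
    congr 1
    field_simp
    push_cast
    linear_combination -h2

/-- Half of the mode of order two of the vertex operator. -/
def quadMode (x₀ : Fin 2 × ℕ+ →₀ ℂ) (a : Fin 2) (e : ℝ) (k : ℤ) (f : TimeSeries) : TimeSeries :=
  quadDeriv a k f + lsum (fun r : ℕ => mu x₀ a r * dZ a (k + r) f) + quadMu x₀ a (-k) * f +
    (e : ℂ) • (dZ a k f + mu x₀ a (-k) * f) + ((e : ℂ) * (e - 1) / 2) • if k = 0 then f else 0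

/-- In the proof `e` followed by two digits records the orders in `u` taken from the multiplication
and the derivation factor; `(1+u)ᵉ` supplies the rest of the total order two. The factor `1/2`
cancels `2!`. -/
theorem half_smul_vertexMode_two (x₀ : Fin 2 × ℕ+ →₀ ℂ) (a : Fin 2) (e : ℝ) (k : ℤ)
    (f : TimeSeries) : (1 / 2 : ℂ) • vertexMode x₀ a e k 2 f = quadMode x₀ a e k f := by
  have h2 : ((Ring.choose e 2 : ℝ) : ℂ) = (e : ℂ) * (e - 1) / 2 := by
    have := ring_choose_two e
    rw [eq_div_iff two_ne_zero, mul_comm]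
    exact_mod_cast this
  have e02 : lsum (fun r : ℕ => if 0 ≤ k + r then
      vertexMul x₀ a 0 r * vertexDeriv a 2 (k + r).toNat f else 0) = quadDeriv a k f := by
    rw [lsum_eq_single 0 fun r hr => by simp [vertexMul_zero, hr]]
    by_cases hk : 0 ≤ k
    · lift k to ℕ using hk
      simp [vertexMul_zero, vertexDeriv_two]
    · have : Ioo 0 k = ∅ := Ioo_eq_empty (by omega)
      simp [hk, quadDeriv, dZ_of_nonpos a (show k ≤ 0 by omega), this]
  have e11 : lsum (fun r : ℕ => if 0 ≤ k + r then
      vertexMul x₀ a 1 r * vertexDeriv a 1 (k + r).toNat f else 0) =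
      lsum (fun r : ℕ => mu x₀ a r * dZ a (k + r) f) := by
    congr 1
    funext r
    split_ifs with h
    · rw [vertexMul_one, vertexDeriv_one]
      rfl
    · rw [dZ_of_nonpos a (by omega), LinearMap.zero_apply, mul_zero]
  have e20 : lsum (fun r : ℕ => if 0 ≤ k + r then
      vertexMul x₀ a 2 r * vertexDeriv a 0 (k + r).toNat f else 0) = quadMu x₀ a (-k) * f := by
    by_cases hk : k ≤ 0
    · rw [lsum_eq_single (-k).toNat fun r hr => by
        split_ifs with h
        · rw [vertexDeriv_zero, if_neg (by omega), LinearMap.zero_apply, mul_zero]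
        · rfl]
      rw [if_pos (by omega), vertexDeriv_zero, if_pos (by omega), vertexMul_two,
        Int.toNat_of_nonneg (by omega), Module.End.one_apply]
    · have : Ioo 0 (-k) = ∅ := Ioo_eq_empty (by omega)
      rw [lsum_eq_zero, quadMu, this, mu_of_nonpos _ _ (by omega)]
      · simp
      · intro r
        rw [if_pos (by omega), vertexDeriv_zero, if_neg (by omega), LinearMap.zero_apply, mul_zero]
  have e01 : lsum (fun r : ℕ => if 0 ≤ k + r then
      vertexMul x₀ a 0 r * vertexDeriv a 1 (k + r).toNat f else 0) = dZ a k f := by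
    rw [lsum_eq_single 0 fun r hr => by simp [vertexMul_zero, hr]]
    by_cases hk : 0 ≤ k
    · lift k to ℕ using hk
      simp [vertexMul_zero, vertexDeriv_one, dZ_natCast]
    · simp [hk, dZ_of_nonpos a (show k ≤ 0 by omega)]
  have e10 : lsum (fun r : ℕ => if 0 ≤ k + r then
      vertexMul x₀ a 1 r * vertexDeriv a 0 (k + r).toNat f else 0) = mu x₀ a (-k) * f := by
    by_cases hk : k ≤ 0
    · rw [lsum_eq_single (-k).toNat fun r hr => by
        split_ifs with h
        · rw [vertexDeriv_zero, if_neg (by omega), LinearMap.zero_apply, mul_zero]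
        · rfl]
      rw [if_pos (by omega), vertexDeriv_zero, if_pos (by omega), vertexMul_one,
        Int.toNat_of_nonneg (by omega), Module.End.one_apply]
    · rw [lsum_eq_zero, mu_of_nonpos _ _ (by omega), zero_mul]
      intro r
      rw [if_pos (by omega), vertexDeriv_zero, if_neg (by omega), LinearMap.zero_apply, mul_zero]
  have e00 : lsum (fun r : ℕ => if 0 ≤ k + r then
      vertexMul x₀ a 0 r * vertexDeriv a 0 (k + r).toNat f else 0) = if k = 0 then f else 0 := by
    rw [lsum_eq_single 0 fun r hr => by simp [vertexMul_zero, hr]]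
    by_cases hk : k = 0
    · simp [hk, vertexMul_zero, vertexDeriv_zero]
    · simp only [Nat.cast_zero, add_zero, hk, if_false]
      split_ifs with h
      · rw [vertexDeriv_zero, if_neg (by omega), LinearMap.zero_apply, mul_zero]
      · rfl
  rw [vertexMode, smul_smul, quadMode]
  simp only [sum_range_succ, sum_range_zero, zero_add, Nat.antidiagonal_succ, Nat.sub_zero,
    Nat.antidiagonal_zero, sum_cons, sum_map, sum_singleton, map_singleton,
    Nat.sub_self, Ring.choose_zero_right, Ring.choose_one_right, h2]
  simp only [Nat.factorial, Function.Embedding.prodMap, Function.Embedding.coeFn_mk, Prod.map,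
    Function.Embedding.refl_apply, Nat.succ_eq_add_one, Nat.reduceAdd, zero_add,
    e02, e11, e20, e01, e10, e00]
  push_cast
  module

theorem locFin_mu_mul (x₀ : Fin 2 × ℕ+ →₀ ℂ) (a : Fin 2) (g : ℕ → TimeSeries) :
    LocFin fun r : ℕ => mu x₀ a r * g r := by
  have h := ((locFin_time x₀ a).mul_left fun r : ℕ => MvPowerSeries.C (r : ℂ)).mul_right g
  simpa only [← MvPowerSeries.smul_eq_C_mul, ← mu_natCast] using h

theorem quadDeriv_mul (a : Fin 2) (k : ℤ) (f g : TimeSeries) :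
    quadDeriv a k (f * g) = f * quadDeriv a k g + quadDeriv a k f * g +
      ∑ j ∈ Ioo 0 k, dZ a j f * dZ a (k - j) g := by
  have h1 : ∀ j, dZ a j (dZ a (k - j) (f * g)) = dZ a j (dZ a (k - j) f) * g +
      dZ a j f * dZ a (k - j) g + dZ a (k - j) f * dZ a (k - (k - j)) g +
      f * dZ a j (dZ a (k - j) g) := fun j => by
    rw [dZ_mul, map_add, dZ_mul, dZ_mul, sub_sub_cancel]
    ring
  unfold quadDeriv
  simp only [h1, sum_add_distrib, ← sum_mul, ← mul_sum]
  rw [dZ_mul, sum_Ioo_reflect k fun j => dZ a j f * dZ a (k - j) g]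
  simp only [smul_add, mul_sub, sub_mul, mul_smul_comm, smul_mul_assoc]
  module

/-- The terms without derivatives are attached to `g` alone, and only the second order part yields
mixed terms. It is applied with a dressing coefficient as `f` and `τ₁` as `g`. -/
theorem quadMode_mul (x₀ : Fin 2 × ℕ+ →₀ ℂ) (a : Fin 2) (e : ℝ) (k : ℤ) (f g : TimeSeries) :
    quadMode x₀ a e k (f * g) = f * quadMode x₀ a e k g +
      (quadDeriv a k f + lsum (fun r : ℕ => mu x₀ a r * dZ a (k + r) f) + (e : ℂ) • dZ a k f) * g +
      ∑ j ∈ Ioo 0 k, dZ a j f * dZ a (k - j) g := by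
  have h : lsum (fun r : ℕ => mu x₀ a r * dZ a (k + r) (f * g)) =
      lsum (fun r : ℕ => mu x₀ a r * dZ a (k + r) f) * g +
      f * lsum (fun r : ℕ => mu x₀ a r * dZ a (k + r) g) := by
    rw [← lsum_mul_right _ (locFin_mu_mul x₀ a _), ← lsum_mul_left _ (locFin_mu_mul x₀ a _),
      ← lsum_add ((locFin_mu_mul x₀ a _).mul_right _) ((locFin_mu_mul x₀ a _).mul_left _)]
    congr 1
    funext r
    rw [dZ_mul]
    ring
  have h0 : (if k = 0 then f * g else 0) = f * if k = 0 then g else 0 := by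
    split_ifs <;> simp
  unfold quadMode
  rw [h, h0, quadDeriv_mul, dZ_mul]
  simp only [smul_add, mul_add, add_mul, mul_smul_comm, smul_mul_assoc, mul_left_comm f]
  module

theorem quadMode_add_one (x₀ : Fin 2 × ℕ+ →₀ ℂ) (a : Fin 2) (e : ℝ) (k : ℤ) (f : TimeSeries) :
    quadMode x₀ a (e + 1) k f = quadMode x₀ a e k f + dZ a k f + mu x₀ a (-k) * f +
      (e : ℂ) • if k = 0 then f else 0 := by
  unfold quadMode
  push_cast
  module

theorem GZ_quadDeriv (a b : Fin 2) (n k : ℤ) (f : TimeSeries) :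
    GZ b n (quadDeriv a k f) = quadDeriv a k (GZ b n f) := by
  simp only [quadDeriv, map_sub, map_smul, map_sum, GZ_dZ]

theorem GZ_quadMode_of_ne (x₀ : Fin 2 × ℕ+ →₀ ℂ) {a b : Fin 2} (hab : b ≠ a) (e : ℝ) (n k : ℤ)
    (f : TimeSeries) : GZ b n (quadMode x₀ a e k f) = quadMode x₀ a e k (GZ b n f) := by
  have h1 := (mem_lsumMaps.1 (GZ_mem_lsumMaps b n) _ _
    (locFin_mu_mul x₀ a fun r => dZ a (k + r) f)).2
  have h2 : GZ b n (quadMu x₀ a (-k) * f) = quadMu x₀ a (-k) * GZ b n f := by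
    simp only [quadMu, add_mul, smul_mul_assoc, sum_mul, mul_assoc, map_add, map_smul, map_sum,
      GZ_mu_mul_of_ne x₀ hab]
  unfold quadMode
  simp only [map_add, map_smul, h1, h2, GZ_mu_mul_of_ne x₀ hab, GZ_dZ, GZ_quadDeriv,
    apply_ite (GZ b n), map_zero]

theorem GZ_quadMu_mul (x₀ : Fin 2 × ℕ+ →₀ ℂ) (a : Fin 2) (n p : ℤ) (f : TimeSeries) :
    GZ a n (quadMu x₀ a p * f) = quadMu x₀ a p * GZ a n f -
      ∑ j ∈ Ioo 0 p, mu x₀ a j * GZ a (n - p + j) f := by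
  by_cases hp : 0 < p
  · have h1 : ∀ j ∈ Ioo 0 p, GZ a n (mu x₀ a j * (mu x₀ a (p - j) * f)) =
        mu x₀ a j * mu x₀ a (p - j) * GZ a n f - mu x₀ a j * GZ a (n - p + j) f -
          mu x₀ a (p - j) * GZ a (n - p + (p - j)) f + GZ a (n - p) f := by
      intro j hj
      simp only [mem_Ioo] at hj
      rw [GZ_mu_mul x₀ a n j hj.1, GZ_mu_mul x₀ a n (p - j) (by omega),
        GZ_mu_mul x₀ a (n - j) (p - j) (by omega), show n - (p - j) = n - p + j by ring,
        show n - j - (p - j) = n - p by ring, show n - p + (p - j) = n - j by ring]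
      ring
    have hc : ((Ioo 0 p).card : ℂ) = p - 1 := by
      rw [Int.card_Ioo, ← Int.cast_natCast, Int.toNat_of_nonneg (by omega)]
      push_cast; ring
    simp only [quadMu, add_mul, smul_mul_assoc, sum_mul, map_add, map_smul, map_sum,
      GZ_mu_mul x₀ a n p hp]
    simp only [mul_assoc] at h1 ⊢
    rw [sum_congr rfl h1, sum_add_distrib, sum_sub_distrib, sum_sub_distrib,
      sum_Ioo_reflect p fun j => mu x₀ a j * GZ a (n - p + j) f, sum_const,
      ← Nat.cast_smul_eq_nsmul ℂ, hc]
    module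
  · have : Ioo 0 p = ∅ := Ioo_eq_empty (by omega)
    simp [quadMu, this, mu_of_nonpos x₀ a (show p ≤ 0 by omega)]

/-- The derivatives commute with `G`, so the corrections come from translating the times: the first
sum from the terms `r x_r ∂_{k+r}`, the second from the quadratic function `quadMu`, the last from
`e` times `mu x₀ a (-k)`. -/
theorem GZ_quadMode (x₀ : Fin 2 × ℕ+ →₀ ℂ) (a : Fin 2) (e : ℝ) (n k J : ℤ) (hJ : n ≤ J)
    (f : TimeSeries) :
    GZ a n (quadMode x₀ a e k f) = quadMode x₀ a e k (GZ a n f) -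
      ∑ r ∈ Ioc 0 J, dZ a (k + r) (GZ a (n - r) f) -
      ∑ j ∈ Ioo 0 (-k), mu x₀ a j * GZ a (n + k + j) f -
      (e : ℂ) • if k < 0 then GZ a (n + k) f else 0 := by
  have hl := (mem_lsumMaps.1 (GZ_mem_lsumMaps a n) _ _
    (locFin_mu_mul x₀ a fun r => dZ a (k + r) f)).2
  have h1 : ∀ r : ℕ, GZ a n (mu x₀ a r * dZ a (k + r) f) = mu x₀ a r * dZ a (k + r) (GZ a n f) -
      if 0 < (r : ℤ) then dZ a (k + r) (GZ a (n - r) f) else 0 := fun r => by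
    split_ifs with h
    · rw [GZ_mu_mul x₀ a n r h, GZ_dZ, GZ_dZ]
    · simp [mu_of_nonpos x₀ a (not_lt.1 h)]
  have h2 : lsum (fun r : ℕ => if 0 < (r : ℤ) then dZ a (k + r) (GZ a (n - r) f) else 0) =
      ∑ r ∈ Ioc 0 J, dZ a (k + r) (GZ a (n - r) f) ∧
      LocFin (fun r : ℕ => if 0 < (r : ℤ) then dZ a (k + r) (GZ a (n - r) f) else 0) := by
    have h0 : ∀ q : ℤ, q ∉ Ioc 0 J →
        (if 0 < q then dZ a (k + q) (GZ a (n - q) f) else 0) = 0 := fun q hq => by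
      simp only [mem_Ioc, not_and_or, not_lt, not_le] at hq
      split_ifs with h
      · rw [GZ_of_neg a (by omega), LinearMap.zero_apply, map_zero]
      · rfl
    constructor
    · have h3 := lsum_int_eq_nat 0
        (f := fun q : ℤ => if 0 < q then dZ a (k + q) (GZ a (n - q) f) else 0)
        fun q hq => if_neg (by omega)
      simp only [zero_add] at h3
      rw [← h3, lsum_eq_sum (Ioc 0 J) h0]
      exact sum_congr rfl fun q hq => if_pos (mem_Ioc.1 hq).1
    · exact .comp_injective
        (f := fun q : ℤ => if 0 < q then dZ a (k + q) (GZ a (n - q) f) else 0)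
        (.of_support (Ioc 0 J : Finset ℤ) (finite_toSet _) h0) Nat.cast_injective
  have h3 : GZ a n (mu x₀ a (-k) * f) = mu x₀ a (-k) * GZ a n f -
      if k < 0 then GZ a (n + k) f else 0 := by
    split_ifs with h
    · rw [GZ_mu_mul x₀ a n (-k) (by omega), sub_neg_eq_add]
    · simp [mu_of_nonpos x₀ a (show -k ≤ 0 by omega)]
  unfold quadMode
  simp only [map_add, map_smul, hl, h1, h3, GZ_quadMu_mul, GZ_dZ, GZ_quadDeriv]
  rw [lsum_sub (locFin_mu_mul x₀ a _) h2.2, h2.1, apply_ite (GZ a n), map_zero]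
  simp only [sub_neg_eq_add]
  module

/-! ### Linearity of the product of difference operators -/

namespace DiffOp

theorem sub_mul_apply {A B Y : DiffOp} (hA : Composable A Y) (hB : Composable B Y) (n : ℤ)
    (s : ℝ) : ((A - B) ⋆ Y) n s = (A ⋆ Y) n s - (B ⋆ Y) n s := by
  simp only [mul_apply]
  rw [← lsum_sub (hA n s) (hB n s)]
  simp only [Pi.sub_apply, sub_mul]

theorem IsPoly.add_mul_apply {D E : DiffOp} (hD : IsPoly D) (hE : IsPoly E) (Y : DiffOp) (n : ℤ)
    (s : ℝ) : ((D + E) ⋆ Y) n s = (D ⋆ Y) n s + (E ⋆ Y) n s := by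
  simp only [mul_apply]
  rw [← lsum_add (hD.composable Y n s) (hE.composable Y n s)]
  simp only [Pi.add_apply, add_mul]

theorem IsPoly.fun_mul_mul_apply {D : DiffOp} (hD : IsPoly D) (f : ℝ → TimeSeries) (Y : DiffOp)
    (n : ℤ) (s : ℝ) : ((fun n s => f s * D n s) ⋆ Y) n s = f s * (D ⋆ Y) n s := by
  rw [mul_apply, mul_apply, ← lsum_mul_left _ (hD.composable Y n s)]
  congr 1
  funext i
  exact _root_.mul_assoc _ _ _

theorem IsPoly.mul_sub_apply {D : DiffOp} (hD : IsPoly D) (A B : DiffOp) (n : ℤ) (s : ℝ) :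
    (D ⋆ (A - B)) n s = (D ⋆ A) n s - (D ⋆ B) n s := by
  rw [mul_apply, mul_apply, mul_apply, ← lsum_sub (hD.composable A n s) (hD.composable B n s)]
  congr 1
  funext i
  exact mul_sub _ _ _

theorem smul_mul_apply (c : ℂ) (D Y : DiffOp) (n : ℤ) (s : ℝ) :
    ((c • D) ⋆ Y) n s = c • (D ⋆ Y) n s := by
  simp only [mul_apply, Pi.smul_apply, smul_mul_assoc]
  exact lsum_smul c _

theorem KillsOne.sum_mul_apply {κ : Type} {D : κ → DiffOp} (S : Finset κ)
    (hD : ∀ i ∈ S, KillsOne (D i)) (Y : DiffOp) (n : ℤ) (s : ℝ) :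
    ((∑ i ∈ S, D i) ⋆ Y) n s = ∑ i ∈ S, (D i ⋆ Y) n s := by
  simp only [mul_apply]
  rw [← lsum_finset_sum S fun i hi => (hD i hi).isPoly.composable Y n s]
  simp only [Finset.sum_apply, sum_mul]

end DiffOp

/-! ### Second order identity for the flows -/

/-- The evolution of `Y` under the flows, with a correction `Y Λ^q` for the lower dressing
operator (`ε = 1`). -/
def HasFlow (a : Fin 2) (w : ℕ → ℝ → TimeSeries) (ε : ℂ) (Y : DiffOp) : Prop :=
  ∀ q : ℤ, 1 ≤ q → ∀ n s,
    ((L₁pow w q).deltaPos ⋆ Y) n s = dZ a q (Y n s) + ε • Y (n - q) s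

/-- The logarithmic derivative of `∑ wᵢ z⁻ⁱ`. -/
theorem exists_logDeriv {w : ℕ → ℝ → TimeSeries}
    (hw : ∀ s, MvPowerSeries.constantCoeff (w 0 s) ≠ 0) :
    ∃ v : ℤ → ℝ → TimeSeries, (∀ q ≤ 0, ∀ s, v q s = 0) ∧
      ∀ (n J : ℤ) (s : ℝ), -n ≤ J →
        (n : ℂ) • lowerOp w n s = ∑ j ∈ Ioc 0 J, v j s * lowerOp w (n + j) s := by
  have h1 : ∀ s, ∃ v : PowerSeries TimeSeries, PowerSeries.coeff 0 v = 0 ∧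
      v * PowerSeries.mk (fun i => w i s) =
        PowerSeries.mk fun i => (-(i : ℂ)) • w i s := fun s => by
    have hu : IsUnit (PowerSeries.mk fun i => w i s) := by
      rw [PowerSeries.isUnit_iff_constantCoeff, PowerSeries.constantCoeff_mk,
        MvPowerSeries.isUnit_iff_constantCoeff]
      exact (hw s).isUnit
    obtain ⟨u, hu⟩ := hu.exists_right_inv
    -- With `z⁻¹` as variable, `z d/dz` multiplies the coefficient of index `i` by `-i`; this is
    -- divided by the series itself, a unit since `w 0 s` is one.
    refine ⟨(PowerSeries.mk fun i => (-(i : ℂ)) • w i s) * u, ?_, ?_⟩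
    · simp [PowerSeries.coeff_mul]
    · rw [mul_assoc, mul_comm u, hu, mul_one]
  choose v hv0 hv using h1
  refine ⟨fun q s => if 0 ≤ q then PowerSeries.coeff q.toNat (v s) else 0, fun q hq s => ?_,
    fun n J s hJ => ?_⟩
  · obtain rfl | h := hq.eq_or_lt
    · simpa using hv0 s
    · exact if_neg (by omega)
  · by_cases hn : 0 < n
    · rw [lowerOp_of_pos w hn, smul_zero, sum_eq_zero]
      intro j hj
      rw [lowerOp_of_pos w (by simp only [mem_Ioc] at hj; omega), mul_zero]
    · obtain ⟨m, rfl⟩ : ∃ m : ℕ, n = -m := ⟨(-n).toNat, by omega⟩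
      have h := congrArg (PowerSeries.coeff m) (hv s)
      rw [PowerSeries.coeff_mul, PowerSeries.coeff_mk] at h
      rw [lowerOp_neg, Int.cast_neg, Int.cast_natCast, ← h]
      have e := sum_antidiagonal_eq_Ioc m (J := J) (by omega)
        (fun i j : ℤ => (if 0 ≤ i then PowerSeries.coeff i.toNat (v s) else 0) * lowerOp w (-j) s)
        (by simp [hv0]) (fun i j hj => by rw [lowerOp_of_pos w (by omega), mul_zero])
      simp only [neg_sub] at e
      simp only [neg_add_eq_sub]
      rw [← e]
      refine sum_congr rfl fun p _ => ?_
      rw [lowerOp_neg, if_pos (by omega), Int.toNat_natCast, PowerSeries.coeff_mk]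

section SecondOrder

variable {a : Fin 2} {w : ℕ → ℝ → TimeSeries} {ε : ℂ} {Y : DiffOp}

/-- Differentiate `B_j Y = ∂_j Y + ε Y Λ^j` along `∂_i` and substitute `∂_i Y = B_i Y - ε Y Λ^i` in
the term `B_j ∂_i Y`. Right multiplication by `Λ^i` commutes with `B_j`, and `ε² = ε` unifies the
two cases. -/
theorem HasFlow.second_order (hY : HasFlow a w ε Y) (hε : ε * ε = ε) {i j : ℤ} (hi : 1 ≤ i)
    (hj : 1 ≤ j) (n : ℤ) (s : ℝ) :
    (((L₁pow w j).deltaPos.deriv a i.toNat + (L₁pow w j).deltaPos ⋆ (L₁pow w i).deltaPos) ⋆ Y) n s =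
      dZ a i (dZ a j (Y n s)) + ε • (dZ a i (Y (n - j) s) + dZ a j (Y (n - i) s) +
        Y (n - i - j) s) := by
  have hB := fun q => killsOne_deltaPos_L₁pow w q
  have h1 := congrFun (congrFun (deriv_mul_of_isPoly a i.toNat (hB j).isPoly Y) n) s
  have h2 : Y.deriv a i.toNat = (L₁pow w i).deltaPos ⋆ Y - fun n s => ε • Y (n - i) s := by
    funext n s
    rw [Pi.sub_apply, Pi.sub_apply, hY i hi]
    exact (add_sub_cancel_right _ _).symm
  have h3 : ((L₁pow w j).deltaPos ⋆ fun n s => ε • Y (n - i) s) n s =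
      ε • ((L₁pow w j).deltaPos ⋆ Y) (n - i) s := by
    simp only [mul_apply]
    rw [← lsum_smul]
    congr 1
    funext m
    rw [mul_smul_comm, show n - m - i = n - i - m by ring]
  have h4 : ((L₁pow w j).deltaPos ⋆ Y.deriv a i.toNat) n s =
      ((L₁pow w j).deltaPos ⋆ ((L₁pow w i).deltaPos ⋆ Y)) n s -
        ε • ((L₁pow w j).deltaPos ⋆ Y) (n - i) s := by
    rw [h2, ← h3]
    exact (hB j).isPoly.mul_sub_apply _ _ n s
  have h5 : ((L₁pow w j).deltaPos ⋆ Y).deriv a i.toNat n s =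
      dZ a i (((L₁pow w j).deltaPos ⋆ Y) n s) := rfl
  rw [Pi.add_apply, Pi.add_apply, h4, h5, hY j hj, hY j hj, map_add, map_smul] at h1
  rw [((hB j).deriv a _).isPoly.add_mul_apply ((hB j).mul (hB i)).isPoly,
    (hB j).isPoly.mul_assoc (hB i).isPoly, ← add_sub_cancel_right
      (((L₁pow w j).deltaPos.deriv a i.toNat ⋆ Y) n s)
      (((L₁pow w j).deltaPos ⋆ ((L₁pow w i).deltaPos ⋆ Y)) n s -
        ε • (dZ a j (Y (n - i) s) + ε • Y (n - i - j) s)), ← h1, smul_add, smul_smul, hε]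
  module

/-- The difference operator that vanishes by the second order identity. -/
def secondOrderOp (a : Fin 2) (w : ℕ → ℝ → TimeSeries) (k : ℤ) (f : ℤ → ℝ → TimeSeries) : DiffOp :=
  ∑ i ∈ Ioo 0 k, ((1 / 2 : ℂ) • ((L₁pow w (k - i)).deltaPos.deriv a i.toNat +
      (L₁pow w (k - i)).deltaPos ⋆ (L₁pow w i).deltaPos) +
    fun n s => -f (k - i) s * (L₁pow w i).deltaPos n s) +
  (-(((k : ℂ) - 1) / 2)) • (L₁pow w k).deltaPos

theorem killsOne_secondOrderOp_summand (a : Fin 2) (w : ℕ → ℝ → TimeSeries) (k : ℤ)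
    (f : ℤ → ℝ → TimeSeries) (i : ℤ) :
    KillsOne ((1 / 2 : ℂ) • ((L₁pow w (k - i)).deltaPos.deriv a i.toNat +
      (L₁pow w (k - i)).deltaPos ⋆ (L₁pow w i).deltaPos) +
    fun n s => -f (k - i) s * (L₁pow w i).deltaPos n s) := by
  have hB := fun q => killsOne_deltaPos_L₁pow w q
  exact ((((hB _).deriv a _).add ((hB _).mul (hB _))).smul _).add ((hB i).mul_left _)

theorem killsOne_secondOrderOp (a : Fin 2) (w : ℕ → ℝ → TimeSeries) (k : ℤ)
    (f : ℤ → ℝ → TimeSeries) : KillsOne (secondOrderOp a w k f) :=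
  (KillsOne.sum _ fun i _ => killsOne_secondOrderOp_summand a w k f i).add
    ((killsOne_deltaPos_L₁pow w k).smul _)

/-- The summand with `L^k` is there to cancel `Y Λ^k`, which the `k - 1` pairs `i + j = k` each
contribute with weight `ε/2`. -/
theorem HasFlow.secondOrderOp_mul (hY : HasFlow a w ε Y) (hε : ε * ε = ε) {k : ℤ} (hk : 1 ≤ k)
    (f : ℤ → ℝ → TimeSeries) (n : ℤ) (s : ℝ) :
    (secondOrderOp a w k f ⋆ Y) n s =
      quadDeriv a k (Y n s) + dZ a k (Y n s) - ∑ j ∈ Ioo 0 k, f j s * dZ a (k - j) (Y n s) +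
      ε • ∑ j ∈ Ioo 0 k, (dZ a j (Y (n - k + j) s) - f j s * Y (n - k + j) s) := by
  have hB := fun q => killsOne_deltaPos_L₁pow w q
  have hs := killsOne_secondOrderOp_summand a w k f
  have h1 : ∀ i ∈ Ioo 0 k, (((1 / 2 : ℂ) • ((L₁pow w (k - i)).deltaPos.deriv a i.toNat +
      (L₁pow w (k - i)).deltaPos ⋆ (L₁pow w i).deltaPos) +
      fun n s => -f (k - i) s * (L₁pow w i).deltaPos n s) ⋆ Y) n s =
      (1 / 2 : ℂ) • dZ a i (dZ a (k - i) (Y n s)) +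
      (1 / 2 * ε) • dZ a i (Y (n - k + i) s) +
      (1 / 2 * ε) • dZ a (k - i) (Y (n - k + (k - i)) s) + (1 / 2 * ε) • Y (n - k) s -
      f (k - i) s * dZ a (k - (k - i)) (Y n s) -
      ε • (f (k - i) s * Y (n - k + (k - i)) s) := by
    intro i hi
    simp only [mem_Ioo] at hi
    rw [((((hB _).deriv a _).add ((hB _).mul (hB _))).smul _).isPoly.add_mul_apply
      ((hB i).mul_left _).isPoly, smul_mul_apply, (hB i).isPoly.fun_mul_mul_apply,
      hY.second_order hε (by omega) (by omega), hY i (by omega), show n - (k - i) = n - k + i by ring,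
      show n - i - (k - i) = n - k by ring, show n - k + (k - i) = n - i by ring, sub_sub_cancel]
    simp only [mul_add, neg_mul, mul_smul_comm]
    module
  have hc : ((Ioo 0 k).card : ℂ) = k - 1 := by
    rw [Int.card_Ioo, ← Int.cast_natCast, Int.toNat_of_nonneg (by omega)]
    push_cast; ring
  rw [secondOrderOp, (KillsOne.sum _ fun i _ => hs i).isPoly.add_mul_apply ((hB k).smul _).isPoly,
    KillsOne.sum_mul_apply _ (fun i _ => hs i), sum_congr rfl h1, smul_mul_apply, hY k hk]
  simp only [sum_sub_distrib, sum_add_distrib, ← smul_sum]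
  rw [sum_Ioo_reflect k fun j => dZ a j (Y (n - k + j) s),
    sum_Ioo_reflect k fun j => f j s * dZ a (k - j) (Y n s),
    sum_Ioo_reflect k fun j => f j s * Y (n - k + j) s, sum_const, ← Nat.cast_smul_eq_nsmul ℂ, hc,
    quadDeriv]
  module

/-- The condition on `f` says that the product with `W` has no positive powers of `Λ`. Multiplying
by `W⁻¹` creates none, so the operator is a function that annihilates `1`. -/
theorem secondOrderOp_eq_zero (hw : ∀ s, MvPowerSeries.constantCoeff (w 0 s) ≠ 0)
    (hW : HasFlow a w 1 (lowerOp w)) {k : ℤ} (hk : 1 ≤ k) (f : ℤ → ℝ → TimeSeries)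
    (hf : ∀ (n : ℤ) (s : ℝ), 1 ≤ n → ∑ j ∈ Ioo 0 k,
      (dZ a j (lowerOp w (n - k + j) s) - f j s * lowerOp w (n - k + j) s) = 0) :
    secondOrderOp a w k f = 0 := by
  have h1 := killsOne_secondOrderOp a w k f
  refine h1.eq_zero fun n s hn => ?_
  rw [← mul_shift_zero (secondOrderOp a w k f), ← lowerOp_mul_invCoeff hw,
    ← h1.isPoly.tame.mul_assoc (tame_lowerOp w) (tame_lowerOp _), mul_apply]
  refine lsum_eq_zero fun i => ?_
  by_cases hi : 1 ≤ i
  · rw [hW.secondOrderOp_mul (one_mul 1) hk, hf i s hi, lowerOp_of_pos w hi]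
    simp [quadDeriv]
  · rw [lowerOp_of_pos (invCoeff (-1) w) (by omega), mul_zero]

end SecondOrder

/-! ### One half of the hierarchy -/

/-- The operator `s Λ⁻¹ + ∑_{k ≥ 1} k x_k Λ^{k-1}` for the times `x^{(a+1)}`. -/
def bareM (x₀ : Fin 2 × ℕ+ →₀ ℂ) (a : Fin 2) : DiffOp := fun n s =>
  if n = -1 then MvPowerSeries.C (s : ℂ)
  else if 0 ≤ n then ((n : ℂ) + 1) • time x₀ a (n + 1).toNat else 0

/-- The Orlov–Schulman operator for the times `x^{(a+1)}`, times `L^{k+1}`. -/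
def orlov (x₀ : Fin 2 × ℕ+ →₀ ℂ) (a : Fin 2) (w : ℕ → ℝ → TimeSeries) (k : ℤ) : DiffOp :=
  lowerOp w ⋆ bareM x₀ a ⋆ lowerOp (invCoeff (-1) w) ⋆ L₁pow w (k + 1)

theorem bareM_eq (x₀ : Fin 2 × ℕ+ →₀ ℂ) (a : Fin 2) (n : ℤ) (s : ℝ) :
    bareM x₀ a n s = (if n = -1 then MvPowerSeries.C (s : ℂ) else 0) + mu x₀ a (n + 1) := by
  unfold bareM
  split_ifs with h1 h2
  · rw [mu_of_nonpos _ _ (by omega), add_zero]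
  · rw [mu, zero_add, ← Int.cast_natCast, Int.toNat_of_nonneg (by omega)]
    push_cast
    rfl
  · rw [mu_of_nonpos _ _ (by omega), add_zero]

theorem tame_mu (x₀ : Fin 2 × ℕ+ →₀ ℂ) (a : Fin 2) (k : ℤ) :
    Tame fun q _ => mu x₀ a (q - k) := fun γ => by
  obtain ⟨K, hK⟩ := exists_time_vanishesTo x₀ a γ
  refine ⟨K + k, fun n hn s => ?_⟩
  exact (hK (n - k).toNat (by omega)).smul _

theorem tame_bareM (x₀ : Fin 2 × ℕ+ →₀ ℂ) (a : Fin 2) : Tame (bareM x₀ a) := by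
  have h : bareM x₀ a = ((fun n s => if n = -1 then MvPowerSeries.C (s : ℂ) else 0 : DiffOp) +
      (fun q _ => mu x₀ a (q - -1) : DiffOp) : DiffOp) := by
    funext n s
    exact bareM_eq x₀ a n s
  rw [h]
  exact (Tame.of_bounded (-1) fun n s hn => if_neg (by omega)).add (tame_mu x₀ a _)

namespace DiffOp

theorem Tame.locFin_mul {c : DiffOp} (hc : Tame c) (s : ℝ) (m : ℤ) {g : ℤ → TimeSeries}
    (hg : ∀ q, q < m → g q = 0) : LocFin fun q => c q s * g q := fun γ => by
  obtain ⟨K, hK⟩ := hc γ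
  refine (Set.finite_Icc m K).subset fun q hq => ?_
  by_contra hn
  simp only [Set.mem_Icc, not_and_or, not_le] at hn
  refine hq ?_
  obtain hn | hn := hn
  · simp [hg q hn]
  · exact (hK q hn s).mul_right _ γ le_rfl

end DiffOp

/-- The coefficients `c_q` of `M L^{k+1} = ∑ c_q L^q`. -/
def orlovCoeff (x₀ : Fin 2 × ℕ+ →₀ ℂ) (a : Fin 2) (v : ℤ → ℝ → TimeSeries) (k : ℤ) : DiffOp :=
  fun q s => (if q = k then MvPowerSeries.C (s : ℂ) else 0) + mu x₀ a (q - k) + v (k - q) s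

/-! ### Expansion of the Orlov–Schulman operator in powers of `L` -/

section

variable {x₀ : Fin 2 × ℕ+ →₀ ℂ} {a : Fin 2} {w : ℕ → ℝ → TimeSeries} {v : ℤ → ℝ → TimeSeries}

theorem tame_orlovCoeff (hv0 : ∀ q ≤ 0, ∀ s, v q s = 0) (k : ℤ) :
    Tame (orlovCoeff x₀ a v k) :=
  ((Tame.of_bounded (A := fun q s => if q = k then MvPowerSeries.C (s : ℂ) else 0) k
    fun n s hn => if_neg (by omega)).add (tame_mu x₀ a k)).add
    (Tame.of_bounded (A := fun q s => v (k - q) s) k fun n s hn => hv0 _ (by omega) s)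

theorem lsum_orlovCoeff_mul (hv0 : ∀ q ≤ 0, ∀ s, v q s = 0) (k : ℤ) (s : ℝ) (m : ℤ)
    {g : ℤ → TimeSeries} (hg : ∀ q, q < m → g q = 0) :
    lsum (fun q : ℤ => orlovCoeff x₀ a v k q s * g q) = (s : ℂ) • g k +
      lsum (fun r : ℕ => mu x₀ a r * g (k + r)) +
      ∑ j ∈ Ioc 0 (k - m), v j s * g (k - j) := by
  have h1 : LocFin fun q : ℤ => (if q = k then MvPowerSeries.C (s : ℂ) else 0) * g q :=
    .of_Icc k k fun q hq => by rw [if_neg (by omega), zero_mul]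
  have h2 : LocFin fun q : ℤ => mu x₀ a (q - k) * g q := (tame_mu x₀ a k).locFin_mul s m hg
  have h3 : LocFin fun q : ℤ => v (k - q) s * g q := .of_Icc m k fun q hq => by
    obtain hq | hq := hq
    · rw [hg q hq, mul_zero]
    · rw [hv0 _ (by omega), zero_mul]
  have e1 : lsum (fun q : ℤ => (if q = k then MvPowerSeries.C (s : ℂ) else 0) * g q) =
      (s : ℂ) • g k := by
    rw [lsum_eq_single k fun q hq => by rw [if_neg hq, zero_mul], if_pos rfl,
      MvPowerSeries.smul_eq_C_mul]
  have e2 : lsum (fun q : ℤ => mu x₀ a (q - k) * g q) =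
      lsum (fun r : ℕ => mu x₀ a r * g (k + r)) := by
    rw [lsum_int_eq_nat k fun q hq => by rw [mu_of_nonpos _ _ (by omega), zero_mul]]
    simp
  have e3 : lsum (fun q : ℤ => v (k - q) s * g q) =
      ∑ j ∈ Ioc 0 (k - m), v j s * g (k - j) := by
    rw [← lsum_comp_equiv (Equiv.subLeft k)]
    simp only [Equiv.subLeft_apply, sub_sub_cancel]
    refine lsum_eq_sum _ fun j hj => ?_
    simp only [mem_Ioc, not_and_or, not_lt, not_le] at hj
    obtain hj | hj := hj
    · rw [hv0 _ hj, zero_mul]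
    · rw [hg _ (by omega), mul_zero]
  unfold orlovCoeff
  simp only [add_mul]
  rw [lsum_add (h1.add h2) h3, lsum_add h1 h2, e1, e2, e3]

variable (hw : ∀ s, MvPowerSeries.constantCoeff (w 0 s) ≠ 0)
  (hv0 : ∀ q ≤ 0, ∀ s, v q s = 0)
  (hv : ∀ (n J : ℤ) (s : ℝ), -n ≤ J →
    (n : ℂ) • lowerOp w n s = ∑ j ∈ Ioc 0 J, v j s * lowerOp w (n + j) s)

include hv0 hv in
-- Moving `s` to the left through `Λ⁻ⁱ` turns it into `s - i`. The terms `-i wᵢ` are the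
-- coefficients of `z∂_z w(z) = v(z) w(z)`, which is how `v` enters `orlovCoeff`.
theorem dressed_bareM (k n : ℤ) (s : ℝ) :
    (lowerOp w ⋆ bareM x₀ a ⋆ shift (k + 1)) n s =
      lsum fun q : ℤ => orlovCoeff x₀ a v k q s * lowerOp w (n - q) s := by
  have hg : ∀ q, q < n → lowerOp w (n - q) s = 0 := fun q hq => lowerOp_of_pos w (by omega) s
  have h1 : LocFin fun q : ℤ =>
      ((if q = k then MvPowerSeries.C (s : ℂ) else 0) + mu x₀ a (q - k)) * lowerOp w (n - q) s :=
    ((Tame.of_bounded (A := fun q s => if q = k then MvPowerSeries.C (s : ℂ) else 0) k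
      fun n s hn => if_neg (by omega)).add (tame_mu x₀ a k)).locFin_mul s n hg
  have h2 : LocFin fun q : ℤ => if q = k then ((n - k : ℤ) : ℂ) • lowerOp w (n - k) s else 0 :=
    .of_Icc k k fun q hq => if_neg (by omega)
  have h3 : LocFin fun q : ℤ => v (k - q) s * lowerOp w (n - q) s := .of_Icc n k fun q hq => by
    obtain hq | hq := hq
    · rw [hg q hq, mul_zero]
    · rw [hv0 _ (by omega), zero_mul]
  have e3 : lsum (fun q : ℤ => v (k - q) s * lowerOp w (n - q) s) =
      lsum fun q : ℤ => if q = k then ((n - k : ℤ) : ℂ) • lowerOp w (n - k) s else 0 := by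
    rw [lsum_eq_single k fun q hq => if_neg hq, if_pos rfl, hv (n - k) (k - n) s (by omega),
      ← lsum_comp_equiv (Equiv.subLeft k)]
    simp only [Equiv.subLeft_apply, sub_sub_cancel]
    rw [lsum_eq_sum (Ioc 0 (k - n))]
    · exact sum_congr rfl fun j _ => by rw [show n - (k - j) = n - k + j by ring]
    · intro j hj
      simp only [mem_Ioc, not_and_or, not_lt, not_le] at hj
      obtain hj | hj := hj
      · rw [hv0 _ hj, zero_mul]
      · rw [hg _ (by omega), mul_zero]
  unfold orlovCoeff
  simp only [add_mul _ (v _ _)]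
  rw [lsum_add h1 h3, e3, ← lsum_add h1 h2, mul_shift, mul_apply,
    ← lsum_comp_equiv (Equiv.subLeft n)]
  congr 1
  funext q
  rw [Equiv.subLeft_apply, bareM_eq, show n - (k + 1) - (n - q) + 1 = q - k by ring]
  by_cases hq : q = k
  · subst hq
    rw [if_pos rfl, if_pos rfl, if_pos (by ring), MvPowerSeries.smul_eq_C_mul]
    push_cast
    simp only [map_add, map_sub]
    ring
  · rw [if_neg hq, if_neg hq, if_neg (by omega)]
    ring

include hw hv0 hv in
theorem orlov_expansion (k n : ℤ) (s : ℝ) :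
    orlov x₀ a w k n s = lsum fun q : ℤ => orlovCoeff x₀ a v k q s * L₁pow w q n s := by
  have t := fun w => tame_lowerOp w
  have h : orlov x₀ a w k =
      lowerOp w ⋆ bareM x₀ a ⋆ shift (k + 1) ⋆ lowerOp (invCoeff (-1) w) := by
    have t1 := (t w).mul (tame_bareM x₀ a)
    rw [orlov, L₁pow, t1.mul_assoc (t _) (((t w).mul (tame_shift _)).mul (t _)),
      ← (t _).mul_assoc ((t w).mul (tame_shift _)) (t _),
      ← (t _).mul_assoc (t w) (tame_shift _), invCoeff_mul_lowerOp hw, shift_zero_mul,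
      ← t1.mul_assoc (tame_shift _) (t _)]
  rw [h]
  exact expansion_of_dressed (tame_orlovCoeff hv0 k) (dressed_bareM hv0 hv k) n s

include hw hv0 hv in
theorem orlov_mul_lowerOp (k n : ℤ) (s : ℝ) :
    (orlov x₀ a w k ⋆ lowerOp w) n s =
      lsum fun q : ℤ => orlovCoeff x₀ a v k q s * lowerOp w (n - q) s := by
  have t := fun w => tame_lowerOp w
  have h : orlov x₀ a w k ⋆ lowerOp w = lowerOp w ⋆ bareM x₀ a ⋆ shift (k + 1) := by
    have t1 := (t w).mul (tame_bareM x₀ a)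
    rw [orlov, L₁pow, t1.mul_assoc (t _) (((t w).mul (tame_shift _)).mul (t _)),
      ← (t _).mul_assoc ((t w).mul (tame_shift _)) (t _),
      ← (t _).mul_assoc (t w) (tame_shift _), invCoeff_mul_lowerOp hw, shift_zero_mul,
      ← t1.mul_assoc (tame_shift _) (t _), (t1.mul (tame_shift _)).mul_assoc (t _) (t _),
      invCoeff_mul_lowerOp hw, mul_shift_zero]
  rw [h, dressed_bareM hv0 hv]

include hw hv0 hv in
-- Each `(L^q)_{Δ,≥1}` acts as the flow `∂_q`, and for `q ≤ 0` both this projection and `dZ a q`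
-- vanish.
theorem orlov_deltaPos_mul {ε : ℂ} {Y : DiffOp} (hY : HasFlow a w ε Y) (k n : ℤ) (s : ℝ) :
    ((orlov x₀ a w k).deltaPos ⋆ Y) n s = lsum fun q : ℤ =>
      orlovCoeff x₀ a v k q s * (dZ a q (Y n s) + ε • if 1 ≤ q then Y (n - q) s else 0) := by
  rw [deltaPos_mul_expansion (tame_orlovCoeff hv0 k) (orlov_expansion hw hv0 hv k)]
  congr 1
  funext q
  congr 1
  by_cases hq : 1 ≤ q
  · rw [hY q hq, if_pos hq]
  · rw [if_neg hq, dZ_of_nonpos a (by omega), smul_zero, add_zero, LinearMap.zero_apply, mul_apply]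
    exact lsum_eq_zero fun i => by rw [deltaPos_L₁pow_eq_zero w (by omega), zero_mul]

theorem lsum_orlovCoeff_mul_dZ (hv0 : ∀ q ≤ 0, ∀ s, v q s = 0) (k : ℤ) (s : ℝ) (f : TimeSeries) :
    lsum (fun q : ℤ => orlovCoeff x₀ a v k q s * dZ a q f) = (s : ℂ) • dZ a k f +
      lsum (fun r : ℕ => mu x₀ a r * dZ a (k + r) f) +
      ∑ j ∈ Ioo 0 k, v j s * dZ a (k - j) f := by
  rw [lsum_orlovCoeff_mul hv0 k s 1 fun q hq => by
    rw [dZ_of_nonpos a (by omega), LinearMap.zero_apply]]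
  congr 1
  refine sum_congr ?_ fun _ _ => rfl
  ext j
  simp only [mem_Ioc, mem_Ioo]
  omega

end

theorem DiffOp.Tame.deltaPos {A : DiffOp} (hA : Tame A) : Tame A.deltaPos := fun γ => by
  obtain ⟨K, hK⟩ := hA γ
  refine ⟨max K 0, fun n hn s => ?_⟩
  rw [DiffOp.deltaPos, if_pos (by omega)]
  exact hK n (by omega) s

/-- The part of the modified Toda hierarchy that concerns the times `x^{(a+1)}`, with its tau
functions. -/
structure IsHalfSolution (a b : Fin 2) (w w' : ℕ → ℝ → TimeSeries) (τ₀ τ₁ : ℝ → TimeSeries) :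
    Prop where
  ne : b ≠ a
  w_ne : ∀ s, MvPowerSeries.constantCoeff (w 0 s) ≠ 0
  τ₁_ne : ∀ s, MvPowerSeries.constantCoeff (τ₁ s) ≠ 0
  flow : ∀ k : ℕ, 1 ≤ k →
    (lowerOp w).deriv a k = -((L₁pow w k).deltaNonpos ⋆ lowerOp w)
  flow' : ∀ k : ℕ, 1 ≤ k →
    (upperOp w').deriv a k = (L₁pow w k).deltaPos ⋆ upperOp w'
  wave : ∀ i s, w i s * τ₁ s = G a i (τ₀ s)
  wave' : ∀ i s, w' i s * τ₁ s = G b i (τ₀ (s + 1))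

namespace IsHalfSolution

variable {a b : Fin 2} {w w' : ℕ → ℝ → TimeSeries} {τ₀ τ₁ : ℝ → TimeSeries}
  (h : IsHalfSolution a b w w' τ₀ τ₁)

include h

theorem hasFlow : HasFlow a w 1 (lowerOp w) := by
  intro q hq n s
  lift q to ℕ using by omega
  have h1 := congrFun (congrFun (h.flow q (by omega)) n) s
  have hB := killsOne_deltaPos_L₁pow w q
  rw [Pi.neg_apply, Pi.neg_apply, deltaNonpos,
    sub_mul_apply ((tame_L₁pow w q).composable (tame_lowerOp w)) (hB.isPoly.composable _),
    L₁pow_mul_lowerOp h.w_ne] at h1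
  have h2 : (lowerOp w).deriv a q n s = dZ a q (lowerOp w n s) := rfl
  rw [← h2, h1]
  module

theorem hasFlow' : HasFlow a w 0 (upperOp w') := by
  intro q hq n s
  lift q to ℕ using by omega
  rw [← h.flow' q (by omega), zero_smul, add_zero]
  rfl

theorem lowerOp_mul (n : ℤ) (s : ℝ) : lowerOp w n s * τ₁ s = GZ a (-n) (τ₀ s) := by
  by_cases hn : 0 < n
  · rw [lowerOp_of_pos w hn, GZ_of_neg a (by omega), zero_mul, LinearMap.zero_apply]
  · obtain ⟨m, rfl⟩ : ∃ m : ℕ, n = -m := ⟨(-n).toNat, by omega⟩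
    rw [lowerOp_neg, h.wave, neg_neg, GZ_natCast]

theorem upperOp_mul (n : ℤ) (s : ℝ) : upperOp w' n s * τ₁ s = GZ b n (τ₀ (s + 1)) := by
  by_cases hn : n < 0
  · rw [upperOp_of_neg w' hn, GZ_of_neg b hn, zero_mul, LinearMap.zero_apply]
  · lift n to ℕ using by omega
    rw [upperOp_natCast, h.wave', GZ_natCast]

theorem τ₁_ne_zero (s : ℝ) : τ₁ s ≠ 0 := fun h0 => h.τ₁_ne s (by rw [h0, map_zero])

variable {v : ℤ → ℝ → TimeSeries}
  (hv : ∀ (n J : ℤ) (s : ℝ), -n ≤ J →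
    (n : ℂ) • lowerOp w n s = ∑ j ∈ Ioc 0 J, v j s * lowerOp w (n + j) s)

include hv

/-- Two expressions for `z∂_z (w(z)τ₁)`: the recursion for `G` applied to `τ₀`, and `v(z)` times the
series. -/
theorem sum_dZ_lowerOp (n J : ℤ) (s : ℝ) (hJ : -n ≤ J) :
    ∑ j ∈ Ioc 0 J, (dZ a j (lowerOp w (n + j) s * τ₁ s) - v j s * lowerOp w (n + j) s * τ₁ s) =
      0 := by
  have h1 := intCast_smul_GZ a (-n) J hJ (τ₀ s)
  have h2 : ∀ j, GZ a (-n - j) (τ₀ s) = lowerOp w (n + j) s * τ₁ s := fun j => by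
    rw [h.lowerOp_mul, neg_add, sub_eq_add_neg]
  simp only [h2] at h1
  rw [sum_sub_distrib, ← sum_mul, ← hv n J s hJ, smul_mul_assoc, h.lowerOp_mul,
    ← neg_eq_iff_eq_neg.2 h1]
  push_cast
  module

theorem second_order_identity {ε : ℂ} {Y : DiffOp} (hY : HasFlow a w ε Y)
    (hε : ε * ε = ε) (k n : ℤ) (s : ℝ) :
    (quadDeriv a k (Y n s) + dZ a k (Y n s)) * τ₁ s +
      ∑ j ∈ Ioo 0 k, dZ a j (Y n s) * dZ a (k - j) (τ₁ s) =
    (∑ j ∈ Ioo 0 k, v j s * dZ a (k - j) (Y n s)) * τ₁ s -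
      ε • ∑ j ∈ Ioo 0 k,
        (dZ a j (Y (n - k + j) s * τ₁ s) - v j s * Y (n - k + j) s * τ₁ s) := by
  by_cases hk : k < 1
  · have : Ioo 0 k = ∅ := Ioo_eq_empty (by omega)
    simp [this, quadDeriv, dZ_of_nonpos a (show k ≤ 0 by omega)]
  -- The relation `sum_dZ_lowerOp` concerns `W τ₁`; subtracting `∂_jτ₁/τ₁` from `v_j` turns it into
  -- the relation for `W` required by `secondOrderOp_eq_zero`.
  set f : ℤ → ℝ → TimeSeries := fun j s => v j s - dZ a j (τ₁ s) * (τ₁ s)⁻¹ with hf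
  have hfτ : ∀ j s, f j s * τ₁ s = v j s * τ₁ s - dZ a j (τ₁ s) := fun j s => by
    rw [hf]
    dsimp only
    rw [sub_mul, mul_assoc, MvPowerSeries.inv_mul_cancel _ (h.τ₁_ne s), mul_one]
  have hterm : ∀ (Z : DiffOp) (j m : ℤ) (s : ℝ), (dZ a j (Z m s) - f j s * Z m s) * τ₁ s =
      dZ a j (Z m s * τ₁ s) - v j s * Z m s * τ₁ s := fun Z j m s => by
    rw [dZ_mul]
    linear_combination (-Z m s) * hfτ j s
  have h0 : secondOrderOp a w k f = 0 := by
    refine secondOrderOp_eq_zero h.w_ne h.hasFlow (by omega) f fun n s hn => ?_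
    refine mul_right_cancel₀ (h.τ₁_ne_zero s) ?_
    -- For `n ≥ 1` the indices `j ≥ k` would only meet positive powers of `Λ` in `W`, so the range
    -- `0 < j < k` already carries the whole relation.
    rw [sum_mul, zero_mul, ← h.sum_dZ_lowerOp hv (n - k) (k - 1) s (by omega)]
    refine sum_congr ?_ fun j _ => hterm (lowerOp w) j _ s
    ext j
    simp only [mem_Ioo, mem_Ioc]
    omega
  have h1 := hY.secondOrderOp_mul hε (show 1 ≤ k by omega) f n s
  have h2 : ((0 : DiffOp) ⋆ Y) n s = 0 := lsum_eq_zero fun i => zero_mul _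
  rw [h0, h2] at h1
  have h3 := congrArg (fun x => x * τ₁ s) h1
  simp only [zero_mul, add_mul, sub_mul, smul_mul_assoc, sum_mul] at h3
  have h4 : ∑ j ∈ Ioo 0 k, f j s * dZ a (k - j) (Y n s) * τ₁ s =
      ∑ j ∈ Ioo 0 k, v j s * dZ a (k - j) (Y n s) * τ₁ s -
        ∑ j ∈ Ioo 0 k, dZ a j (Y n s) * dZ a (k - j) (τ₁ s) := by
    rw [← sum_Ioo_reflect k fun j => dZ a j (Y n s) * dZ a (k - j) (τ₁ s), ← sum_sub_distrib]
    refine sum_congr rfl fun j _ => ?_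
    rw [sub_sub_cancel]
    linear_combination (dZ a (k - j) (Y n s)) * hfτ j s
  have h5 : ∑ j ∈ Ioo 0 k, (dZ a j (Y (n - k + j) s) * τ₁ s - f j s * Y (n - k + j) s * τ₁ s) =
      ∑ j ∈ Ioo 0 k, (dZ a j (Y (n - k + j) s * τ₁ s) - v j s * Y (n - k + j) s * τ₁ s) :=
    sum_congr rfl fun j _ => by rw [← hterm Y j _ s]; exact (sub_mul _ _ _).symm
  rw [h4, h5] at h3
  rw [add_mul, sum_mul]
  linear_combination -h3

variable (hv0 : ∀ q ≤ 0, ∀ s, v q s = 0)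

include hv0

/-- Here `G` belongs to the other set of times and commutes with the mode. The exponent is `s + 1`:
the expansion of `M L^{k+1}` gives `s ∂_k`, and the second order identity supplies one more `∂_k`.
-/
theorem induces_upper_aux (x₀ : Fin 2 × ℕ+ →₀ ℂ) (k n : ℤ) (s : ℝ) :
    ((orlov x₀ a w k).deltaPos ⋆ upperOp w') n s * τ₁ s +
      upperOp w' n s * quadMode x₀ a (s + 1) k (τ₁ s) =
    GZ b n (quadMode x₀ a (s + 1) k (τ₀ (s + 1))) := by
  have h1 := h.second_order_identity hv h.hasFlow' (zero_mul 0) k n s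
  rw [GZ_quadMode_of_ne x₀ h.ne, ← h.upperOp_mul, quadMode_mul,
    orlov_deltaPos_mul h.w_ne hv0 hv h.hasFlow']
  simp only [zero_smul, add_zero, sub_zero] at h1 ⊢
  rw [lsum_orlovCoeff_mul_dZ hv0]
  push_cast
  rw [add_smul, one_smul]
  linear_combination -h1

/-- Write `-A_{Δ,≤0} W = A_{Δ,≥1} W - A W`. The terms `W Λ^q` with `q ≥ 1` cancel and those with `q
≤ 0` survive. -/
theorem deltaNonpos_orlov_mul (x₀ : Fin 2 × ℕ+ →₀ ℂ) (k n : ℤ) (s : ℝ) :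
    -((orlov x₀ a w k).deltaNonpos ⋆ lowerOp w) n s =
      lsum (fun q : ℤ => orlovCoeff x₀ a v k q s * dZ a q (lowerOp w n s)) -
      lsum (fun q : ℤ => orlovCoeff x₀ a v k q s * if q ≤ 0 then lowerOp w (n - q) s else 0) := by
  have hc := tame_orlovCoeff (x₀ := x₀) (a := a) hv0 k
  have hW : ∀ q, q < n → lowerOp w (n - q) s = 0 := fun q hq => lowerOp_of_pos w (by omega) s
  have l1 := hc.locFin_mul s 1 (g := fun q => dZ a q (lowerOp w n s)) fun q hq => by
    rw [dZ_of_nonpos a (by omega), LinearMap.zero_apply]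
  have l2 := hc.locFin_mul s n (g := fun q => if q ≤ 0 then lowerOp w (n - q) s else 0)
    fun q hq => by rw [hW q hq, ite_self]
  have l3 := hc.locFin_mul s n (g := fun q => lowerOp w (n - q) s) hW
  have l4 := hc.locFin_mul s 1
    (g := fun q => dZ a q (lowerOp w n s) + (1 : ℂ) • if 1 ≤ q then lowerOp w (n - q) s else 0)
    fun q hq => by
      rw [dZ_of_nonpos a (by omega), LinearMap.zero_apply, if_neg (by omega), smul_zero, add_zero]
  have hA : Tame (orlov x₀ a w k) :=
    (((tame_lowerOp w).mul (tame_bareM x₀ a)).mul (tame_lowerOp _)).mul (tame_L₁pow w _)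
  rw [deltaNonpos, sub_mul_apply (hA.composable (tame_lowerOp w))
      (hA.deltaPos.composable (tame_lowerOp w)), neg_sub,
    orlov_deltaPos_mul h.w_ne hv0 hv h.hasFlow, orlov_mul_lowerOp h.w_ne hv0 hv,
    ← lsum_sub l4 l3, ← lsum_sub l1 l2]
  congr 1
  funext q
  by_cases hq : 1 ≤ q
  · rw [if_pos hq, if_neg (by omega), one_smul]
    ring
  · rw [if_neg hq, if_pos (by omega), smul_zero]
    ring

omit h hv in
theorem lsum_orlovCoeff_lowerOp_nonpos (x₀ : Fin 2 × ℕ+ →₀ ℂ) (k n J : ℤ) (s : ℝ)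
    (hJ : k - n ≤ J) :
    lsum (fun q : ℤ => orlovCoeff x₀ a v k q s * if q ≤ 0 then lowerOp w (n - q) s else 0) =
      ((s : ℂ) • if k ≤ 0 then lowerOp w (n - k) s else 0) +
      ∑ j ∈ Ioc 0 (-k), mu x₀ a j * lowerOp w (n - k - j) s +
      ∑ j ∈ Ioc 0 J with k ≤ j, v j s * lowerOp w (n - k + j) s := by
  rw [lsum_orlovCoeff_mul hv0 k s n fun q hq => by rw [lowerOp_of_pos w (by omega), ite_self]]
  congr 1
  · congr 1
    have e := lsum_int_eq_nat 0 (f := fun r : ℤ =>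
      mu x₀ a r * if k + r ≤ 0 then lowerOp w (n - (k + r)) s else 0) fun q hq => by
        rw [mu_of_nonpos _ _ (by omega), zero_mul]
    simp only [zero_add] at e
    rw [← e, lsum_eq_sum (Ioc 0 (-k))]
    · refine sum_congr rfl fun j hj => ?_
      rw [if_pos (by simp only [mem_Ioc] at hj; omega), sub_sub]
    · intro j hj
      simp only [mem_Ioc, not_and_or, not_lt, not_le] at hj
      obtain hj | hj := hj
      · rw [mu_of_nonpos _ _ hj, zero_mul]
      · rw [if_neg (by omega), mul_zero]
  · rw [sum_filter, ← sum_subset (Ioc_subset_Ioc_right hJ)]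
    · refine sum_congr rfl fun j _ => ?_
      by_cases hj : k ≤ j
      · rw [if_pos hj, if_pos (by omega), show n - (k - j) = n - k + j by ring]
      · rw [if_neg hj, if_neg (by omega), mul_zero]
    · intro j hj hj'
      rw [lowerOp_of_pos w (by simp only [mem_Ioc] at *; omega), mul_zero, ite_self]

/-- Now `G` does not commute with the mode. Its corrections match the surviving terms `W Λ^q`, `q ≤
0`, together with the change of exponent from `s + 1` to `s`. The relation `sum_dZ_lowerOp`, split
at `j = k`, links the indices below `k`, from the second order identity, to those from `k` on. -/
theorem induces_lower_aux (x₀ : Fin 2 × ℕ+ →₀ ℂ) (k n : ℤ) (s : ℝ) :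
    -((orlov x₀ a w k).deltaNonpos ⋆ lowerOp w) n s * τ₁ s +
      lowerOp w n s * quadMode x₀ a (s + 1) k (τ₁ s) =
    GZ a (-n) (quadMode x₀ a s k (τ₀ s)) := by
  obtain ⟨J, hJk, hJn⟩ : ∃ J : ℤ, k ≤ J ∧ k - n ≤ J :=
    ⟨max k (k - n), le_max_left _ _, le_max_right _ _⟩
  set D : ℤ → TimeSeries := fun j => dZ a j (lowerOp w (n - k + j) s * τ₁ s) with hD
  have h1 := h.second_order_identity hv h.hasFlow (one_mul 1) k n s
  have hG : ∀ j, GZ a (-j) (τ₀ s) = lowerOp w j s * τ₁ s := fun j => (h.lowerOp_mul j s).symm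
  have hsum := h.sum_dZ_lowerOp hv (n - k) J s (by omega)
  rw [← sum_filter_add_sum_filter_not _ (fun j => k ≤ j)] at hsum
  have hlow : ((Ioc 0 J).filter fun j => ¬ k ≤ j) = Ioo 0 k := by
    ext j
    simp only [mem_filter, mem_Ioc, mem_Ioo]
    omega
  have hhigh : ∑ j ∈ Ioc 0 J with k ≤ j, D j =
      dZ a k (lowerOp w n s * τ₁ s) +
        ∑ r ∈ Ioc 0 (J - k), dZ a (k + r) (lowerOp w (n + r) s * τ₁ s) := by
    -- For `k ≤ 0` the added indices `j ≤ 0` contribute nothing, as `dZ a j` vanishes there.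
    have e1 : ∑ j ∈ Ioc 0 J with k ≤ j, D j = ∑ j ∈ Icc k J, D j := by
      refine sum_subset (fun j hj => ?_) fun j hj hj' => ?_
      · simp only [mem_filter, mem_Ioc, mem_Icc] at *
        omega
      · simp only [mem_filter, mem_Ioc, mem_Icc] at *
        rw [hD]
        dsimp only
        rw [dZ_of_nonpos a (by omega), LinearMap.zero_apply]
    rw [e1, ← sum_Ioc_add_eq_sum_Icc hJk, add_comm, hD]
    dsimp only
    rw [sub_add_cancel]
    congr 1
    refine sum_bij' (fun j _ => j - k) (fun r _ => k + r) ?_ ?_ ?_ ?_ ?_ <;> intro j hj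
    · simp only [mem_Ioc] at *; omega
    · simp only [mem_Ioc] at *; omega
    · ring
    · ring
    · rw [show k + (j - k) = j by ring, show n + (j - k) = n - k + j by ring]
  -- The boundary term `j = -k` is split off; it matches the multiplication by `mu x₀ a (-k)` in
  -- `quadMode_add_one`.
  have hmu : (∑ j ∈ Ioc 0 (-k), mu x₀ a j * lowerOp w (n - k - j) s) * τ₁ s =
      ∑ j ∈ Ioo 0 (-k), mu x₀ a j * (lowerOp w (n - k - j) s * τ₁ s) +
        mu x₀ a (-k) * (lowerOp w n s * τ₁ s) := by
    by_cases hk : k < 0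
    · have e : Ioc 0 (-k) = insert (-k) (Ioo 0 (-k)) := (Ioo_insert_right (by omega)).symm
      rw [e, sum_insert (by simp), add_mul, sum_mul, sub_neg_eq_add, sub_add_cancel, add_comm]
      simp only [mul_assoc]
    · rw [Ioc_eq_empty (by omega), Ioo_eq_empty (by omega), mu_of_nonpos x₀ a (by omega)]
      simp
  have hs : (s : ℂ) • (if k ≤ 0 then lowerOp w (n - k) s else 0) * τ₁ s =
      (s : ℂ) • (if k < 0 then lowerOp w (n - k) s * τ₁ s else 0) +
        lowerOp w n s * (s : ℂ) • (if k = 0 then τ₁ s else 0) := by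
    obtain hk | hk | hk := lt_trichotomy k 0
    · rw [if_pos hk.le, if_pos hk, if_neg hk.ne, smul_zero, mul_zero, add_zero, smul_mul_assoc]
    · rw [if_pos hk.le, if_neg (by omega), if_pos hk, hk, sub_zero, smul_mul_assoc, mul_smul_comm,
        smul_zero, zero_add]
    · rw [if_neg (by omega), if_neg (by omega), if_neg (by omega)]
      simp
  rw [GZ_quadMode x₀ a s (-n) k (J - k) (by omega)]
  simp only [show ∀ r, -n - r = -(n + r) by intro r; ring,
    show -n + k = -(n - k) by ring,
    show ∀ j, -(n - k) + j = -(n - k - j) by intro j; ring, hG]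
  rw [quadMode_mul, quadMode_add_one, h.deltaNonpos_orlov_mul hv hv0,
    lsum_orlovCoeff_lowerOp_nonpos hv0 x₀ k n J s hJn, lsum_orlovCoeff_mul_dZ hv0]
  rw [hlow, sum_sub_distrib, hhigh, dZ_mul] at hsum
  rw [one_smul] at h1
  have hv' : (∑ j ∈ Ioc 0 J with k ≤ j, v j s * lowerOp w (n - k + j) s) * τ₁ s =
    ∑ j ∈ Ioc 0 J with k ≤ j, v j s * lowerOp w (n - k + j) s * τ₁ s := sum_mul _ _ _
  linear_combination -h1 - hmu - hs - hv' + hsum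

end IsHalfSolution

/-! ### Reflection -/

/-- The exchange of `Λ` and `Λ⁻¹` together with `s ↦ -s`. -/
def DiffOp.reflect (A : DiffOp) : DiffOp := fun n s => A (-n) (-s)

namespace DiffOp

theorem reflect_apply (A : DiffOp) (n : ℤ) (s : ℝ) : A.reflect n s = A (-n) (-s) := rfl

theorem reflect_mul (A B : DiffOp) : (A ⋆ B).reflect = A.reflect ⋆ B.reflect := by
  funext n s
  rw [reflect_apply, mul_apply, mul_apply, ← lsum_comp_equiv (Equiv.neg ℤ)]
  congr 1
  funext i
  rw [reflect_apply, reflect_apply, Equiv.neg_apply]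
  congr 2
  · ring
  · push_cast; ring

theorem Composable.of_reflect {A B : DiffOp} (h : Composable A.reflect B.reflect) :
    Composable A B := fun n s => by
  have h1 := (h (-n) (-s)).comp_injective (Equiv.neg ℤ).injective
  convert h1 using 2 with i
  rw [reflect_apply, reflect_apply, Equiv.neg_apply]
  congr 2
  · ring
  · ring
  · ring
  · push_cast; ring

theorem Composable.smul {A B : DiffOp} (c : ℂ) (h : Composable A B) : Composable (c • A) B :=
  fun n s => by
    have := (h n s).smul c
    simpa only [Pi.smul_apply, smul_mul_assoc] using this

theorem reflect_shift (p : ℤ) : (shift p).reflect = shift (-p) := by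
  funext n s
  rw [reflect_apply, shift, shift]
  exact if_congr (by omega) rfl rfl

theorem reflect_deltaStarPos (A : DiffOp) : A.deltaStarPos.reflect = A.reflect.deltaPos := by
  funext n s
  rw [reflect_apply, deltaStarPos, deltaPos]
  refine if_congr (by omega) rfl (if_congr (by omega) rfl rfl)

theorem reflect_deltaStarNonpos (A : DiffOp) :
    A.deltaStarNonpos.reflect = A.reflect.deltaNonpos := by
  funext n s
  rw [deltaNonpos, ← reflect_deltaStarPos]
  rfl

end DiffOp

theorem reflect_lowerOp (w : ℕ → ℝ → TimeSeries) :
    (lowerOp w).reflect = upperOp fun i s => w i (-s) := by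
  funext n s
  rw [reflect_apply, lowerOp, upperOp]
  exact if_congr (by omega) (by rw [neg_neg]) rfl

theorem reflect_upperOp (w : ℕ → ℝ → TimeSeries) :
    (upperOp w).reflect = lowerOp fun i s => w i (-s) := by
  funext n s
  rw [reflect_apply, lowerOp, upperOp]
  exact if_congr (by omega) rfl rfl

theorem invCoeff_neg (w : ℕ → ℝ → TimeSeries) (n : ℕ) (s : ℝ) :
    invCoeff 1 w n (-s) = invCoeff (-1) (fun i s => w i (-s)) n s := by
  induction n using Nat.strong_induction_on generalizing s with
  | _ n ih =>
    cases n with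
    | zero => simp [invCoeff]
    | succ n =>
      rw [invCoeff, invCoeff]
      congr 1
      refine sum_congr rfl fun i _ => ?_
      rw [← ih _ (by omega)]
      congr 2
      push_cast
      ring

theorem reflect_L₂pow (w : ℕ → ℝ → TimeSeries) (p : ℤ) :
    (L₂pow w p).reflect = L₁pow (fun i s => w i (-s)) p := by
  rw [L₂pow, L₁pow, reflect_mul, reflect_mul, reflect_upperOp, reflect_upperOp, reflect_shift,
    neg_neg]
  simp only [invCoeff_neg]

theorem reflect_bareM₂ (x₀ : Fin 2 × ℕ+ →₀ ℂ) : (bareM₂ x₀).reflect = bareM x₀ 1 := by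
  funext n s
  rw [reflect_apply, bareM₂, bareM]
  refine if_congr (by omega) ?_ (if_congr (by omega) ?_ rfl)
  · push_cast
    rw [map_neg, neg_neg]
  · rw [sub_neg_eq_add, add_comm (1 : ℤ)]
    push_cast
    rw [sub_neg_eq_add, add_comm (1 : ℂ)]

theorem reflect_M₂_mul_L₂pow (x₀ : Fin 2 × ℕ+ →₀ ℂ) (w : ℕ → ℝ → TimeSeries) (k : ℤ) :
    (M₂ x₀ w ⋆ L₂pow w (k + 1)).reflect = orlov x₀ 1 (fun i s => w i (-s)) k := by
  rw [M₂, orlov, reflect_mul, reflect_mul, reflect_mul, reflect_L₂pow, reflect_upperOp,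
    reflect_upperOp, reflect_bareM₂]
  simp only [invCoeff_neg]

/-! ### The two halves of the hierarchy -/

section Halves

variable {w₁ w₂ : ℕ → ℝ → TimeSeries} {τ₀ τ₁ : ℝ → TimeSeries}

theorem IsTauPair.mul₁ (hτ : IsTauPair w₁ w₂ τ₀ τ₁) (i : ℕ) (s : ℝ) :
    w₁ i s * τ₁ s = G 0 i (τ₀ s) := by
  rw [hτ.wave₁, mul_assoc, MvPowerSeries.inv_mul_cancel _ (hτ.τ₁_ne s), mul_one]

theorem IsTauPair.mul₂ (hτ : IsTauPair w₁ w₂ τ₀ τ₁) (i : ℕ) (s : ℝ) :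
    w₂ i s * τ₁ s = G 1 i (τ₀ (s + 1)) := by
  rw [hτ.wave₂, mul_assoc, MvPowerSeries.inv_mul_cancel _ (hτ.τ₁_ne s), mul_one]

theorem IsModifiedToda.half₁ (hW : IsModifiedToda w₁ w₂) (hτ : IsTauPair w₁ w₂ τ₀ τ₁) :
    IsHalfSolution 0 1 w₁ w₂ τ₀ τ₁ where
  ne := by decide
  w_ne := hW.w₁_ne
  τ₁_ne := hτ.τ₁_ne
  flow := hW.flow₁₁
  flow' := hW.flow₁₂
  wave := hτ.mul₁
  wave' := hτ.mul₂

/-- Reflection makes `W₂` the lower operator. The shift in `τ₀(1 - s)` is needed because `w₂` is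
tied to `τ₀(s + 1)` and `w₁` to `τ₀(s)`, whereas in a half solution the lower operator goes with the
unshifted function. -/
theorem IsModifiedToda.half₂ (hW : IsModifiedToda w₁ w₂) (hτ : IsTauPair w₁ w₂ τ₀ τ₁) :
    IsHalfSolution 1 0 (fun i s => w₂ i (-s)) (fun i s => w₁ i (-s)) (fun s => τ₀ (1 - s))
      (fun s => τ₁ (-s)) where
  ne := by decide
  w_ne s := hW.w₂_ne _
  τ₁_ne s := hτ.τ₁_ne _
  flow k hk := by
    have h := congrArg reflect (hW.flow₂₂ k hk)
    rw [← reflect_upperOp, ← reflect_L₂pow, ← reflect_deltaStarNonpos, ← reflect_mul]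
    exact h
  flow' k hk := by
    have h := congrArg reflect (hW.flow₂₁ k hk)
    rw [← reflect_lowerOp, ← reflect_L₂pow, ← reflect_deltaStarPos, ← reflect_mul]
    exact h
  wave i s := by
    rw [hτ.mul₂, neg_add_eq_sub]
  wave' i s := by
    rw [hτ.mul₁]
    congr 2
    ring

end Halves

/-- The index `s - 1` of `W^{(2)}` becomes the exponent `-s + 1`, which is the exponent of
`induces_upper_aux` at the reflected point `-s`. -/
theorem virasoroτ₀_eq (x₀ : Fin 2 × ℕ+ →₀ ℂ) (N M : ℕ) (l : ℤ) (τ₀ : ℝ → TimeSeries) (s : ℝ) :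
    virasoroτ₀ x₀ N M l τ₀ s = (1 / N : ℂ) • quadMode x₀ 0 s (N * l) (τ₀ s) +
      (1 / M : ℂ) • quadMode x₀ 1 (-s + 1) (M * l) (τ₀ s) := by
  rw [virasoroτ₀, Wgen₁, Wgen₂, ← half_smul_vertexMode_two, ← half_smul_vertexMode_two,
    show -(s - 1) = -s + 1 by ring]
  module

theorem virasoroτ₁_eq (x₀ : Fin 2 × ℕ+ →₀ ℂ) (N M : ℕ) (l : ℤ) (τ₁ : ℝ → TimeSeries) (s : ℝ) :
    virasoroτ₁ x₀ N M l τ₁ s = (1 / N : ℂ) • quadMode x₀ 0 (s + 1) (N * l) (τ₁ s) +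
      (1 / M : ℂ) • quadMode x₀ 1 (-s + 1) (M * l) (τ₁ s) := by
  rw [virasoroτ₁, Wgen₁, Wgen₂, ← half_smul_vertexMode_two, ← half_smul_vertexMode_two,
    show -(s - 1) = -s + 1 by ring]
  module

/-! ### The Virasoro action on the tau functions -/

section Existence

variable {w₁ w₂ : ℕ → ℝ → TimeSeries} {τ₀ τ₁ : ℝ → TimeSeries}

theorem tame_orlov (x₀ : Fin 2 × ℕ+ →₀ ℂ) (a : Fin 2) (w : ℕ → ℝ → TimeSeries) (k : ℤ) :
    Tame (orlov x₀ a w k) :=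
  (((tame_lowerOp w).mul (tame_bareM x₀ a)).mul (tame_lowerOp _)).mul (tame_L₁pow w _)

/-- The Orlov–Schulman operators involve infinitely many times, so their positive parts need not be
polynomial. Both factors have only nonnegative powers of `Λ`, which suffices. -/
theorem composable_deltaPos_upperOp (A : DiffOp) (w : ℕ → ℝ → TimeSeries) :
    Composable A.deltaPos (upperOp w) := fun n s => .of_Icc 0 n fun i hi => by
  obtain hi | hi := hi
  · rw [deltaPos, if_neg (by omega), if_neg (by omega), zero_mul]
  · rw [upperOp_of_neg w (by omega), mul_zero]

theorem DiffOp.Tame.deltaNonpos {A : DiffOp} (hA : Tame A) : Tame A.deltaNonpos := fun γ => by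
  obtain ⟨K, hK⟩ := hA γ
  refine ⟨max K 0, fun n hn s => ?_⟩
  have : A.deltaNonpos n s = 0 := by
    rw [DiffOp.deltaNonpos, Pi.sub_apply, Pi.sub_apply, DiffOp.deltaPos, if_pos (by omega), sub_self]
  rw [this]
  exact vanishesTo_zero γ

theorem virasoroW₁_mul (x₀ : Fin 2 × ℕ+ →₀ ℂ) (N M : ℕ) (hW : IsModifiedToda w₁ w₂)
    (hτ : IsTauPair w₁ w₂ τ₀ τ₁) (l n : ℤ) (s : ℝ) :
    virasoroW₁ x₀ N M w₁ w₂ l n s * τ₁ s + lowerOp w₁ n s * virasoroτ₁ x₀ N M l τ₁ s =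
      GZ 0 (-n) (virasoroτ₀ x₀ N M l τ₀ s) := by
  obtain ⟨v, hv0, hv⟩ := exists_logDeriv hW.w₁_ne
  obtain ⟨v', hv0', hv'⟩ := exists_logDeriv (w := fun i s => w₂ i (-s)) fun s => hW.w₂_ne (-s)
  have h1 := (hW.half₁ hτ).induces_lower_aux hv hv0 x₀ (N * l) n s
  have h2 := (hW.half₂ hτ).induces_upper_aux hv' hv0' x₀ (M * l) (-n) (-s)
  rw [← reflect_M₂_mul_L₂pow, ← reflect_deltaStarPos, ← reflect_lowerOp, ← reflect_mul] at h2
  simp only [reflect_apply, neg_neg] at h2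
  rw [show 1 - (-s + 1) = s by ring] at h2
  have c1 : Composable (M₂ x₀ w₂ ⋆ L₂pow w₂ (M * l + 1)).deltaStarPos (lowerOp w₁) := by
    refine .of_reflect ?_
    rw [reflect_deltaStarPos, reflect_lowerOp]
    exact composable_deltaPos_upperOp _ _
  have c2 : Composable (orlov x₀ 0 w₁ (N * l)).deltaNonpos (lowerOp w₁) :=
    (tame_orlov x₀ 0 w₁ _).deltaNonpos.composable (tame_lowerOp w₁)
  have e : virasoroW₁ x₀ N M w₁ w₂ l n s =
      (1 / M : ℂ) • ((M₂ x₀ w₂ ⋆ L₂pow w₂ (M * l + 1)).deltaStarPos ⋆ lowerOp w₁) n s -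
      (1 / N : ℂ) • ((orlov x₀ 0 w₁ (N * l)).deltaNonpos ⋆ lowerOp w₁) n s := by
    rw [← smul_mul_apply, ← smul_mul_apply, ← sub_mul_apply (c1.smul _) (c2.smul _)]
    rfl
  rw [virasoroτ₀_eq, virasoroτ₁_eq, map_add, map_smul, map_smul, ← h1, ← h2, e]
  simp only [sub_mul, mul_add, smul_mul_assoc, mul_smul_comm, smul_add, neg_mul, smul_neg]
  ring

theorem virasoroW₂_mul (x₀ : Fin 2 × ℕ+ →₀ ℂ) (N M : ℕ) (hW : IsModifiedToda w₁ w₂)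
    (hτ : IsTauPair w₁ w₂ τ₀ τ₁) (l n : ℤ) (s : ℝ) :
    virasoroW₂ x₀ N M w₁ w₂ l n s * τ₁ s + upperOp w₂ n s * virasoroτ₁ x₀ N M l τ₁ s =
      GZ 1 n (virasoroτ₀ x₀ N M l τ₀ (s + 1)) := by
  obtain ⟨v, hv0, hv⟩ := exists_logDeriv hW.w₁_ne
  obtain ⟨v', hv0', hv'⟩ := exists_logDeriv (w := fun i s => w₂ i (-s)) fun s => hW.w₂_ne (-s)
  have h1 := (hW.half₁ hτ).induces_upper_aux hv hv0 x₀ (N * l) n s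
  have h2 := (hW.half₂ hτ).induces_lower_aux hv' hv0' x₀ (M * l) (-n) (-s)
  rw [← reflect_M₂_mul_L₂pow, ← reflect_deltaStarNonpos, ← reflect_upperOp, ← reflect_mul] at h2
  simp only [reflect_apply, neg_neg] at h2
  rw [show 1 - -s = s + 1 by ring] at h2
  have c1 : Composable (orlov x₀ 0 w₁ (N * l)).deltaPos (upperOp w₂) :=
    composable_deltaPos_upperOp _ _
  have c2 : Composable (M₂ x₀ w₂ ⋆ L₂pow w₂ (M * l + 1)).deltaStarNonpos (upperOp w₂) := by
    refine .of_reflect ?_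
    rw [reflect_deltaStarNonpos, reflect_upperOp, reflect_M₂_mul_L₂pow]
    exact (tame_orlov x₀ 1 _ _).deltaNonpos.composable (tame_lowerOp _)
  have e : virasoroW₂ x₀ N M w₁ w₂ l n s =
      (1 / N : ℂ) • ((orlov x₀ 0 w₁ (N * l)).deltaPos ⋆ upperOp w₂) n s -
      (1 / M : ℂ) • ((M₂ x₀ w₂ ⋆ L₂pow w₂ (M * l + 1)).deltaStarNonpos ⋆ upperOp w₂) n s := by
    rw [← smul_mul_apply, ← smul_mul_apply, ← sub_mul_apply (c1.smul _) (c2.smul _)]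
    rfl
  rw [virasoroτ₀_eq, virasoroτ₁_eq, map_add, map_smul, map_smul, show -(s + 1) + 1 = -s by ring,
    ← h1, ← h2, e]
  simp only [sub_mul, mul_add, smul_mul_assoc, mul_smul_comm, smul_add, neg_mul, smul_neg]
  ring

/-- The two product identities hold for every integer exponent. On the wrong side, where `GZ` and
the dressing coefficients vanish, they give the triangular shape of the variations after cancelling
`τ₁`. -/
theorem induces_virasoro (x₀ : Fin 2 × ℕ+ →₀ ℂ) (N M : ℕ) (hW : IsModifiedToda w₁ w₂)
    (hτ : IsTauPair w₁ w₂ τ₀ τ₁) (l : ℤ) :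
    Induces w₁ w₂ τ₀ τ₁ (virasoroτ₀ x₀ N M l τ₀) (virasoroτ₁ x₀ N M l τ₁)
      (virasoroW₁ x₀ N M w₁ w₂ l) (virasoroW₂ x₀ N M w₁ w₂ l) where
  lower i s hi := by
    have h := virasoroW₁_mul x₀ N M hW hτ l i s
    rw [lowerOp_of_pos w₁ hi, GZ_of_neg 0 (by omega), zero_mul, add_zero,
      LinearMap.zero_apply] at h
    exact (mul_eq_zero.1 h).resolve_right ((hW.half₁ hτ).τ₁_ne_zero s)
  upper i s hi := by
    have h := virasoroW₂_mul x₀ N M hW hτ l i s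
    rw [upperOp_of_neg w₂ hi, GZ_of_neg 1 hi, zero_mul, add_zero, LinearMap.zero_apply] at h
    exact (mul_eq_zero.1 h).resolve_right ((hW.half₁ hτ).τ₁_ne_zero s)
  wave₁ i s := by
    have h := virasoroW₁_mul x₀ N M hW hτ l (-i) s
    rwa [lowerOp_neg, neg_neg, GZ_natCast] at h
  wave₂ i s := by
    have h := virasoroW₂_mul x₀ N M hW hτ l i s
    rwa [upperOp_natCast, GZ_natCast] at h

end Existence

/-! ### Uniqueness -/

/-- Comparing the recursions for `G_k(cτ)` and `c G_k τ` gives `∑ (∂_j c) G_{k-j} τ = 0` over `0 < j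
≤ k`. By induction only `j = k` is left, where `G_0 = 1`. -/
theorem timeDeriv_eq_zero_of_G_mul {a : Fin 2} {c τ : TimeSeries} (hτ : τ ≠ 0)
    (h : ∀ i : ℕ, G a i (c * τ) = c * G a i τ) (k : ℕ) : timeDeriv a k c = 0 := by
  have h' : ∀ n : ℤ, GZ a n (c * τ) = c * GZ a n τ := fun n => by
    by_cases hn : n < 0
    · simp [GZ_of_neg a hn]
    · lift n to ℕ using by omega
      rw [GZ_natCast, h]
  induction k using Nat.strong_induction_on with
  | _ k ih =>
    obtain rfl | hk := k.eq_zero_or_pos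
    · rw [timeDeriv_zero, LinearMap.zero_apply]
    have h1 := intCast_smul_GZ a k k le_rfl (c * τ)
    have h2 := intCast_smul_GZ a k k le_rfl τ
    simp only [h', dZ_mul] at h1
    rw [← mul_smul_comm, h2, sum_add_distrib, ← mul_sum] at h1
    have h3 : ∑ j ∈ Ioc 0 (k : ℤ), dZ a j c * GZ a (k - j) τ = 0 := by
      linear_combination h1
    rw [sum_eq_single (k : ℤ)] at h3
    · rw [sub_self, GZ_zero, Module.End.one_apply, dZ_natCast] at h3
      exact (mul_eq_zero.1 h3).resolve_right hτ
    · intro j hj hjk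
      simp only [mem_Ioc] at hj
      rw [dZ, ih j.toNat (by omega), zero_mul]
    · intro hn
      exact absurd (by simp only [mem_Ioc]; omega) hn

theorem eq_C_of_timeDeriv_eq_zero {c : TimeSeries} (h : ∀ a k, timeDeriv a k c = 0) :
    c = MvPowerSeries.C (MvPowerSeries.constantCoeff c) := by
  classical
  refine MvPowerSeries.pderiv.ext (fun p => ?_) ?_
  · obtain ⟨a, k⟩ := p
    rw [MvPowerSeries.pderiv_C, ← timeDeriv_pnat, h]
  · simp

/-- The leading coefficients of both wave functions show that `η₀` and `η₁` are the same multiple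
`c` of `τ₀` and `τ₁`, and that `c` is periodic; the remaining ones make `c` constant in the times.
-/
theorem exists_const_of_induces_zero {w₁ w₂ : ℕ → ℝ → TimeSeries} {τ₀ τ₁ η₀ η₁ : ℝ → TimeSeries}
    (hτ : IsTauPair w₁ w₂ τ₀ τ₁) (h₁ : ∀ i s, w₁ i s * η₁ s = G 0 i (η₀ s))
    (h₂ : ∀ i s, w₂ i s * η₁ s = G 1 i (η₀ (s + 1))) :
    ∃ c : ℝ → ℂ, (∀ s, c (s + 1) = c s) ∧ (∀ s, η₀ s = c s • τ₀ s) ∧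
      ∀ s, η₁ s = c s • τ₁ s := by
  have ne : ∀ f : TimeSeries, MvPowerSeries.constantCoeff f ≠ 0 → f ≠ 0 := fun f hf h0 =>
    hf (by rw [h0, map_zero])
  have hG : ∀ a, G a 0 = 1 := fun a => by rw [← GZ_natCast, Nat.cast_zero, GZ_zero]
  set c : ℝ → TimeSeries := fun s => η₁ s * (τ₁ s)⁻¹ with hc
  have hc1 : ∀ s, η₁ s = c s * τ₁ s := fun s => by
    rw [hc]
    dsimp only
    rw [mul_assoc, MvPowerSeries.inv_mul_cancel _ (hτ.τ₁_ne s), mul_one]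
  have hc0 : ∀ s, η₀ s = c s * τ₀ s := fun s => by
    have e1 := h₁ 0 s
    have e2 := hτ.mul₁ 0 s
    rw [hG, Module.End.one_apply] at e1 e2
    rw [← e1, ← e2, hc1]
    ring
  have hcs : ∀ s, c (s + 1) = c s := fun s => by
    have e1 := h₂ 0 s
    have e2 := hτ.mul₂ 0 s
    rw [hG, Module.End.one_apply] at e1 e2
    refine mul_right_cancel₀ (ne _ (hτ.τ₀_ne (s + 1))) ?_
    rw [← hc0, ← e1, ← e2, hc1]
    ring
  have hd : ∀ s a k, timeDeriv a k (c s) = 0 := fun s a k => by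
    obtain rfl | rfl : a = 0 ∨ a = 1 := by omega
    · refine timeDeriv_eq_zero_of_G_mul (ne _ (hτ.τ₀_ne s)) (fun i => ?_) k
      rw [← hc0, ← h₁, ← hτ.mul₁, hc1]
      ring
    -- The second set of times only sees `τ₀(s + 1)`, so the periodicity of `c` is used to move
    -- there.
    · rw [← hcs]
      refine timeDeriv_eq_zero_of_G_mul (ne _ (hτ.τ₀_ne (s + 1))) (fun i => ?_) k
      rw [← hc0, ← h₂, ← hτ.mul₂, hc1, hcs]
      ring
  refine ⟨fun s => MvPowerSeries.constantCoeff (c s), fun s => congrArg _ (hcs s), fun s => ?_,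
    fun s => ?_⟩
  · rw [MvPowerSeries.smul_eq_C_mul, ← eq_C_of_timeDeriv_eq_zero (hd s), hc0]
  · rw [MvPowerSeries.smul_eq_C_mul, ← eq_C_of_timeDeriv_eq_zero (hd s), hc1]

end BMTH

end

/-! ### The main theorem -/

open BMTH
theorem mainTheorem6 (N M : ℕ) (hN : 0 < N) (hM : 0 < M) (x₀ : Fin 2 × ℕ+ →₀ ℂ)
    (w₁ w₂ : ℕ → ℝ → TimeSeries) (hW : IsBigradedModifiedToda N M w₁ w₂)
    (τ₀ τ₁ : ℝ → TimeSeries) (hτ : IsTauPair w₁ w₂ τ₀ τ₁) (l : ℤ) (hl : -1 ≤ l) :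
    Induces w₁ w₂ τ₀ τ₁ (virasoroτ₀ x₀ N M l τ₀) (virasoroτ₁ x₀ N M l τ₁)
        (virasoroW₁ x₀ N M w₁ w₂ l) (virasoroW₂ x₀ N M w₁ w₂ l) ∧
      ∀ δτ₀ δτ₁ : ℝ → TimeSeries,
        Induces w₁ w₂ τ₀ τ₁ δτ₀ δτ₁
            (virasoroW₁ x₀ N M w₁ w₂ l) (virasoroW₂ x₀ N M w₁ w₂ l) →
          ∃ c : ℝ → ℂ, (∀ s, c (s + 1) = c s) ∧
            (∀ s, δτ₀ s = virasoroτ₀ x₀ N M l τ₀ s + c s • τ₀ s) ∧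
            (∀ s, δτ₁ s = virasoroτ₁ x₀ N M l τ₁ s + c s • τ₁ s) := by
  have hI := induces_virasoro x₀ N M hW.toIsModifiedToda hτ l
  refine ⟨hI, fun δτ₀ δτ₁ hδ => ?_⟩
  -- The conditions in `Induces` are affine in the change of the tau functions, so the difference of
  -- two solutions satisfies the homogeneous relations.
  obtain ⟨c, hc, h0, h1⟩ := exists_const_of_induces_zero hτ
    (η₀ := δτ₀ - virasoroτ₀ x₀ N M l τ₀) (η₁ := δτ₁ - virasoroτ₁ x₀ N M l τ₁)
    (fun i s => by
      rw [Pi.sub_apply, Pi.sub_apply, map_sub, ← hδ.wave₁, ← hI.wave₁]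
      ring)
    (fun i s => by
      rw [Pi.sub_apply, Pi.sub_apply, map_sub, ← hδ.wave₂, ← hI.wave₂]
      ring)
  exact ⟨c, hc, fun s => sub_eq_iff_eq_add'.1 (h0 s), fun s => sub_eq_iff_eq_add'.1 (h1 s)⟩
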